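/- Let $(M,g)$ be a complete Riemannian manifold (smooth, finite-dimensional, without boundary; complete as a metric space for the Riemannian distance) and let $\nabla$ be any smooth affine connection on $M$, i.e. a smooth connection on $TM$, not assumed to be related to $g$ or to be torsion-free. Let $\gamma : J \to M$, with $J \subseteq \mathbb{R}$ a nonempty open interval, be a maximal nonconstant $\nabla$-geodesic in its affine parameter: $\nabla_{\dot\gamma}\dot\gamma = 0$ on $J$, and $\gamma$ is not the restriction of a $\nabla$-geodesic defined on a strictly larger open interval. An arc-length parametrization of $\gamma$ is a curve $r = \gamma\circ\varphi : S \to M$, where $S$ is an open interval and $\varphi : S \to J$ is a bijective $C^1$ map, with $\|\dot r(s)\|_g = 1$ for all $s \in S$. Then $\gamma$ has an arc-length parametrization, and for every arc-length parametrization $r : S \to M$ of $\gamma$ the parameter runs from $-\infty$ to $\infty$, i.e. $S = \mathbb{R}$. In particular, $\gamma$ has infinite length: $\int_J \|\dot\gamma(t)\|_g\,dt = \infty$. -/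

import Mathlib

open Set MeasureTheory
open scoped Manifold ContDiff Bundle

noncomputable section

namespace AffineGeodesic

variable {E : Type*} [NormedAddCommGroup E] [NormedSpace ℝ E]

section Geodesics

variable {M : Type*} [TopologicalSpace M] [ChartedSpace E M] [IsManifold 𝓘(ℝ, E) ∞ M]

/-- The velocity vector `γ'(t)` of a curve in a manifold. -/
def velocity (γ : ℝ → M) (t : ℝ) : TangentSpace 𝓘(ℝ, E) (γ t) :=
  mfderiv 𝓘(ℝ, ℝ) 𝓘(ℝ, E) γ t (1 : ℝ)

/-- The coordinate vector field `∑ wⁱ ∂/∂xⁱ` with constant components `w ∈ E`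
in the preferred chart at `p`; it is extended by zero outside the domain of the chart. -/
def coordField (p : M) (w : E) (x : M) : TangentSpace 𝓘(ℝ, E) x :=
  (trivializationAt E (TangentSpace 𝓘(ℝ, E)) p).symmL ℝ x w

/-- The components of the tangent vector `v` at `x` in the preferred chart at `p`. -/
def components (p x : M) (v : TangentSpace 𝓘(ℝ, E) x) : E :=
  (trivializationAt E (TangentSpace 𝓘(ℝ, E)) p ⟨x, v⟩).2

/-- The covariant derivative `(DV/dt)(t)` of a vector field `V` along the curve `γ`.
With `∂ᵢ` the coordinate frame of the chart at `γ t` and `V = ∑ Vⁱ ∂ᵢ` near the time `t`, it is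
`∑ (Vⁱ)'(t) ∂ᵢ + ∑ Vⁱ(t) ∇_{γ'(t)} ∂ᵢ`. (The application `cov σ x v` is `(∇_v σ)(x)`.) -/
def covAlong (cov : CovariantDerivative 𝓘(ℝ, E) E (fun x : M ↦ TangentSpace 𝓘(ℝ, E) x))
    (γ : ℝ → M) (V : (t : ℝ) → TangentSpace 𝓘(ℝ, E) (γ t)) (t : ℝ) :
    TangentSpace 𝓘(ℝ, E) (γ t) :=
  coordField (γ t) (deriv (fun τ ↦ components (γ t) (γ τ) (V τ)) t) (γ t)
    + cov (coordField (γ t) (components (γ t) (γ t) (V t))) (γ t) (velocity γ t)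

/-- `γ`, restricted to the nonempty open interval `J`, is a geodesic of the connection `cov`,
parametrized by an affine parameter: it is twice continuously differentiable and `∇_{γ'} γ' = 0`.
(For a smooth connection such a curve is automatically smooth.)
The values of `γ` outside `J` are irrelevant. -/
structure IsGeodesicOn
    (cov : CovariantDerivative 𝓘(ℝ, E) E (fun x : M ↦ TangentSpace 𝓘(ℝ, E) x))
    (γ : ℝ → M) (J : Set ℝ) : Prop where
  isOpen : IsOpen J
  isConnected : IsConnected J
  contMDiffOn : ContMDiffOn 𝓘(ℝ, ℝ) 𝓘(ℝ, E) 2 γ J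
  covAlong_eq_zero : ∀ t ∈ J, covAlong cov γ (velocity γ) t = 0

/-- A geodesic on `J` that is not the restriction of a geodesic on a larger interval. -/
structure IsMaximalGeodesic
    (cov : CovariantDerivative 𝓘(ℝ, E) E (fun x : M ↦ TangentSpace 𝓘(ℝ, E) x))
    (γ : ℝ → M) (J : Set ℝ) : Prop where
  isGeodesicOn : IsGeodesicOn cov γ J
  maximal : ∀ (γ' : ℝ → M) (J' : Set ℝ),
    IsGeodesicOn cov γ' J' → J ⊆ J' → EqOn γ' γ J → J' = J

end Geodesics

section Length

variable {M : Type*} [TopologicalSpace M] [ChartedSpace E M] [IsManifold 𝓘(ℝ, E) ∞ M]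
  [Bundle.RiemannianBundle (fun x : M ↦ TangentSpace 𝓘(ℝ, E) x)]

/-- The curve `r` on the open interval `S` is an arc-length parametrization of the curve `γ` on
`J`: it arises from `γ` by a bijective `C¹` change of parameter `φ : S → J` (of either
orientation), and it has unit speed. (As `r` has unit speed, `φ'` has no zero
when `γ` is differentiable.) -/
structure IsArcLengthParametrization (γ : ℝ → M) (J : Set ℝ) (r : ℝ → M) (S : Set ℝ) : Prop where
  isOpen : IsOpen S
  isConnected : IsConnected S
  exists_reparam : ∃ φ : ℝ → ℝ, ContDiffOn ℝ 1 φ S ∧ BijOn φ S J ∧ EqOn r (γ ∘ φ) S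
  unit_speed : ∀ s ∈ S, ‖velocity (E := E) r s‖ = 1

/-- The length `∫_J ‖γ'(t)‖ dt ∈ [0, ∞]` of the curve `γ` on `J`. -/
def curveLength (γ : ℝ → M) (J : Set ℝ) : ENNReal :=
  ∫⁻ t in J, ‖velocity (E := E) γ t‖ₑ

end Length

end AffineGeodesic

end

/-! Suppose `γ` has finite length towards the right end of `J`. By completeness `γ t` converges
there to a point `p`. In a chart at `p` let `w` be the components of `γ'`; the geodesic equation
reads `w' = -Γ(w, w)`, where `Γ` is bounded near `p`. Estimating one factor `w` by the speed gives
`‖w'‖ ≤ K ‖γ'‖ ‖w‖`, which is linear in `w` and whose rate `‖γ'‖` is the derivative of arc length.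
Grönwall's inequality in terms of arc length (`IsGeodesicOn.exists_norm_components_le`) therefore
keeps `‖w‖` between two positive constants, although nothing is known yet about the duration. No
compatibility of connection and metric is needed.

The lower bound keeps the speed away from zero, so finite length forces a finite right end `T`. The
upper bound makes `w` Lipschitz, so `w` converges at `T`. Then position and velocity both converge,
the geodesic ODE can be solved past `T` (`IsGeodesicOn.exists_extension`), and maximality fails:
this is `IsMaximalGeodesic.not_bddAbove_arcLength`. Time reversal gives the left end.

The same Grönwall inequality shows that a nonconstant geodesic never has zero velocity, so its
arc-length function can be inverted; this yields an arc-length parametrization. In any such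
parametrization, the measure of a parameter set is the length of the corresponding arc. Hence `S`
has infinite measure on both sides of each of its points, and `S = ℝ`. -/

namespace AffineGeodesic

open Filter Module
open scoped Topology

/-! ### Components and coordinate fields in a chart -/

section Frames

variable {E : Type*} [NormedAddCommGroup E] [NormedSpace ℝ E]
  {M : Type*} [TopologicalSpace M] [ChartedSpace E M] [IsManifold 𝓘(ℝ, E) ∞ M]

theorem components_eq_continuousLinearMapAt {p x : M} (hx : x ∈ (chartAt E p).source)
    (v : TangentSpace 𝓘(ℝ, E) x) :
    components p x v =
      (trivializationAt E (TangentSpace 𝓘(ℝ, E)) p).continuousLinearMapAt ℝ x v := by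
  exact (congrFun ((trivializationAt E (TangentSpace 𝓘(ℝ, E)) p).coe_linearMapAt_of_mem
    (R := ℝ) hx) v).symm

theorem components_coordField {p x : M} (hx : x ∈ (chartAt E p).source) (w : E) :
    components p x (coordField p w x) = w := by
  rw [components_eq_continuousLinearMapAt hx]
  exact (trivializationAt E (TangentSpace 𝓘(ℝ, E)) p).continuousLinearMapAt_symmL hx w

theorem coordField_components {p x : M} (hx : x ∈ (chartAt E p).source)
    (v : TangentSpace 𝓘(ℝ, E) x) : coordField p (components p x v) x = v := by
  rw [components_eq_continuousLinearMapAt hx]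
  exact (trivializationAt E (TangentSpace 𝓘(ℝ, E)) p).symmL_continuousLinearMapAt hx v

theorem components_eq_zero_iff {p x : M} (hx : x ∈ (chartAt E p).source)
    {v : TangentSpace 𝓘(ℝ, E) x} : components p x v = 0 ↔ v = 0 := by
  constructor
  · intro h
    rw [← coordField_components hx v, h]
    exact map_zero _
  · rintro rfl
    rw [components_eq_continuousLinearMapAt hx, map_zero]

theorem components_add {p x : M} (hx : x ∈ (chartAt E p).source)
    (v w : TangentSpace 𝓘(ℝ, E) x) :
    components p x (v + w) = components p x v + components p x w := by
  simp only [components_eq_continuousLinearMapAt hx, map_add]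

theorem mdifferentiableAt_coordField {p x : M} (hx : x ∈ (chartAt E p).source) {s : M → E}
    (hs : MDiffAt s x) :
    MDiffAt (T% (fun y ↦ coordField p (s y) y)) x := by
  rw [(trivializationAt E (TangentSpace 𝓘(ℝ, E)) p).mdifferentiableAt_section_iff 𝓘(ℝ, E) _ hx]
  refine hs.congr_of_eventuallyEq ?_
  filter_upwards [(chartAt E p).open_source.mem_nhds hx] with y hy
  exact components_coordField hy (s y)

theorem contMDiffOn_coordField (p : M) (w : E) :
    ContMDiffOn 𝓘(ℝ, E) (𝓘(ℝ, E).prod 𝓘(ℝ, E)) ∞ (T% (coordField p w))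
      (chartAt E p).source := by
  rw [(trivializationAt E (TangentSpace 𝓘(ℝ, E)) p).contMDiffOn_section_iff
    (chartAt E p).open_source (by exact subset_rfl)]
  refine (contMDiffOn_const (c := w)).congr ?_
  intro y hy
  exact components_coordField hy w

end Frames

/-! ### Christoffel symbols of the connection -/

section Christoffel

variable {E : Type*} [NormedAddCommGroup E] [NormedSpace ℝ E] [FiniteDimensional ℝ E]
  {M : Type*} [TopologicalSpace M] [ChartedSpace E M] [IsManifold 𝓘(ℝ, E) ∞ M]
  (cov : CovariantDerivative 𝓘(ℝ, E) E (fun x : M ↦ TangentSpace 𝓘(ℝ, E) x))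

/-- The vector `∇_{∂ⱼ} ∂ᵢ` at `x`, in components, for the coordinate frame of the preferred chart
at `p`. -/
noncomputable def christoffelSymbol (p : M) (i j : Fin (finrank ℝ E)) (x : M) : E :=
  components p x (cov (coordField p (finBasis ℝ E i)) x (coordField p (finBasis ℝ E j) x))

/-- The bilinear map `∑ wⁱ vʲ Γᵢⱼ` formed with the Christoffel symbols of the preferred chart
at `p`. -/
noncomputable def christoffel (p x : M) (w v : E) : E :=
  ∑ i, ∑ j, ((finBasis ℝ E).repr w i * (finBasis ℝ E).repr v j) • christoffelSymbol cov p i j x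

theorem components_cov_basis {p x : M} (hx : x ∈ (chartAt E p).source)
    (i : Fin (finrank ℝ E)) (v : TangentSpace 𝓘(ℝ, E) x) :
    components p x (cov (coordField p (finBasis ℝ E i)) x v) =
      ∑ j, (finBasis ℝ E).repr (components p x v) j • christoffelSymbol cov p i j x := by
  let A : E →L[ℝ] E := (((trivializationAt E (TangentSpace 𝓘(ℝ, E)) p).continuousLinearMapAt ℝ x) ∘L
    (cov (coordField p (finBasis ℝ E i)) x)) ∘L
      (trivializationAt E (TangentSpace 𝓘(ℝ, E)) p).symmL ℝ x
  have hA (w : E) : components p x (cov (coordField p (finBasis ℝ E i)) x (coordField p w x)) =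
      A w := components_eq_continuousLinearMapAt hx _
  conv_lhs => rw [← coordField_components hx v, hA,
    ← (finBasis ℝ E).sum_repr (components p x v), map_sum]
  refine Finset.sum_congr rfl fun j _ ↦ ?_
  rw [map_smul, ← hA]
  rfl

omit [FiniteDimensional ℝ E] in
theorem cov_sum {ι : Type*} (t : Finset ι) (σ : ι → (x : M) → TangentSpace 𝓘(ℝ, E) x) {x : M}
    (hσ : ∀ i, MDiffAt (T% (σ i)) x) :
    cov (∑ i ∈ t, σ i) x = ∑ i ∈ t, cov (σ i) x := by
  classical
  induction t using Finset.induction_on with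
  | empty => simp
  | insert a t ha ih =>
    rw [Finset.sum_insert ha, Finset.sum_insert ha,
      cov.isCovariantDerivativeOnUniv.add (hσ a), ih]
    have := MDifferentiableAt.sum_section (s := t) (fun i _ ↦ hσ i)
    convert this using 3
    simp

/-- The covariant derivative of the vector field with components `s`. -/
theorem components_cov_coordField {p x : M} (hx : x ∈ (chartAt E p).source) {s : M → E}
    (hs : MDiffAt s x) (v : TangentSpace 𝓘(ℝ, E) x) :
    components p x (cov (fun y ↦ coordField p (s y) y) x v) =
      d% s x v + christoffel cov p x (s x) (components p x v) := by
  set b := finBasis ℝ E 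
  let l (i) : E →L[ℝ] ℝ := LinearMap.toContinuousLinearMap (b.coord i)
  have hg (i) : MDiffAt (fun y ↦ b.repr (s y) i) x :=
    (l i).differentiableAt.mdifferentiableAt.comp x hs
  have hb (i) : MDiffAt (T% (coordField p (b i))) x :=
    mdifferentiableAt_coordField hx mdifferentiableAt_const
  have hsum : (fun y ↦ coordField p (s y) y) =
      ∑ i, (fun y ↦ b.repr (s y) i) • coordField p (b i) := by
    funext y
    rw [Finset.sum_apply]
    conv_lhs => rw [← b.sum_repr (s y)]
    exact map_sum ((trivializationAt E (TangentSpace 𝓘(ℝ, E)) p).symmL ℝ y) _ _ |>.trans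
      (Finset.sum_congr rfl fun i _ ↦ map_smul _ _ _)
  have hd : d% s x v = ∑ i, d% (fun y ↦ b.repr (s y) i) x v • b i := by
    rw [← b.sum_repr (d% s x v)]
    refine Finset.sum_congr rfl fun i _ ↦ ?_
    congr 1
    have h := mfderiv_comp x ((l i).differentiableAt.mdifferentiableAt (x := s x)) hs
    rw [(l i).hasMFDerivAt.mfderiv] at h
    exact (congrArg (fun A ↦ A v) h).symm
  rw [hsum, cov_sum cov _ _ fun i ↦ (hg i).smul_section (hb i),
    components_eq_continuousLinearMapAt hx, _root_.sum_apply, map_sum,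
    hd, christoffel, ← Finset.sum_add_distrib]
  refine Finset.sum_congr rfl fun i _ ↦ ?_
  -- The Leibniz rule on each summand: differentiating the coefficient gives the `d% s` term,
  -- differentiating the frame gives the Christoffel term.
  rw [cov.isCovariantDerivativeOnUniv.leibniz (hb i) (hg i), _root_.add_apply,
    map_add, _root_.smul_apply, map_smul, ContinuousLinearMap.smulRight_apply,
    map_smul, ← components_eq_continuousLinearMapAt hx, ← components_eq_continuousLinearMapAt hx,
    components_coordField hx, add_comm, components_cov_basis cov hx, Finset.smul_sum]
  simp only [smul_smul]
  rfl

/-- Smoothness of `cov` is applied to globally smooth fields, whereas a coordinate field is smooth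
only on its chart domain. It is cut off by a bump function equal to `1` near `x`; by locality this
does not change the covariant derivative near `x`. -/
theorem contMDiffAt_christoffelSymbol [T2Space M] [cov.ContMDiffCovariantDerivative ∞]
    {p x : M} (hx : x ∈ (chartAt E p).source) (i j : Fin (finrank ℝ E)) :
    ContMDiffAt 𝓘(ℝ, E) 𝓘(ℝ, E) ∞ (christoffelSymbol cov p i j) x := by
  obtain ⟨ψ, -, hψ⟩ := (SmoothBumpFunction.nhds_basis_tsupport (I := 𝓘(ℝ, E)) x).mem_iff.1
    ((chartAt E p).open_source.mem_nhds hx)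
  set σ := coordField p (finBasis ℝ E i)
  have hσ : CMDiff ∞ (T% ((ψ : M → ℝ) • σ)) :=
    ψ.contMDiff.contMDiffOn.smul_section_of_tsupport (chartAt E p).open_source hψ
      (contMDiffOn_coordField p _)
  have hcov := (CovariantDerivative.ContMDiffCovariantDerivative.contMDiff (cov := cov)
    (k := ∞)).contMDiff (σ := (ψ : M → ℝ) • σ) hσ.contMDiffOn
  have hX : CMDiffAt ∞ (T% (coordField p (finBasis ℝ E j))) x :=
    (contMDiffOn_coordField p _).contMDiffAt ((chartAt E p).open_source.mem_nhds hx)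
  have h1 := (hcov.contMDiffAt univ_mem).clm_bundle_apply hX
  rw [(trivializationAt E (TangentSpace 𝓘(ℝ, E)) p).contMDiffAt_section_iff hx] at h1
  refine h1.congr_of_eventuallyEq ?_
  filter_upwards [ψ.eventuallyEq_one.eventually_nhds, (chartAt E p).open_source.mem_nhds hx]
    with y hy hys
  have : cov ((ψ : M → ℝ) • σ) y = cov σ y := by
    refine cov.isCovariantDerivativeOnUniv.congr_of_eventuallyEq ?_ ?_ univ_mem ?_
    · exact (hσ y).mdifferentiableAt (by simp)
    · exact mdifferentiableAt_coordField hys mdifferentiableAt_const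
    · filter_upwards [hy] with z hz
      simp [hz]
  rw [this]
  rfl

end Christoffel

/-! ### Velocity and acceleration in an arbitrary chart -/

section Charts

variable {E : Type*} [NormedAddCommGroup E] [NormedSpace ℝ E]
  {M : Type*} [TopologicalSpace M] [ChartedSpace E M] [IsManifold 𝓘(ℝ, E) ∞ M]

theorem hasDerivAt_extChartAt_comp {p : M} {γ : ℝ → M} {t : ℝ}
    (ht : γ t ∈ (chartAt E p).source) (hγ : MDiffAt γ t) :
    HasDerivAt (fun τ ↦ extChartAt 𝓘(ℝ, E) p (γ τ)) (components p (γ t) (velocity (E := E) γ t)) t := by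
  rw [components_eq_continuousLinearMapAt ht,
    TangentBundle.continuousLinearMapAt_trivializationAt ht]
  have h1 : MDiffAt (extChartAt 𝓘(ℝ, E) p) (γ t) := mdifferentiableAt_extChartAt ht
  have h2 := h1.hasMFDerivAt.comp t hγ.hasMFDerivAt
  let A : ℝ →L[ℝ] E := (mfderiv% (extChartAt 𝓘(ℝ, E) p) (γ t)).comp (mfderiv% γ t)
  have h3 : HasFDerivAt (fun τ ↦ extChartAt 𝓘(ℝ, E) p (γ τ)) A t := h2.hasFDerivAt
  exact h3.hasDerivAt

theorem contDiffAt_extChartAt_comp {p : M} {γ : ℝ → M} {t : ℝ}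
    (ht : γ t ∈ (chartAt E p).source) (hγ : ContMDiffAt 𝓘(ℝ, ℝ) 𝓘(ℝ, E) 2 γ t) :
    ContDiffAt ℝ 2 (fun τ ↦ extChartAt 𝓘(ℝ, E) p (γ τ)) t := by
  have h : ContMDiffAt 𝓘(ℝ, E) 𝓘(ℝ, E) 2 (extChartAt 𝓘(ℝ, E) p) (γ t) :=
    (contMDiffAt_extChartAt' (n := ∞) ht).of_le (by norm_cast)
  exact (h.comp t hγ).contDiffAt

theorem eventually_mem_and_mdifferentiableAt {p : M} {γ : ℝ → M} {t : ℝ}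
    (ht : γ t ∈ (chartAt E p).source) (hγ : ContMDiffAt 𝓘(ℝ, ℝ) 𝓘(ℝ, E) 2 γ t) :
    ∀ᶠ τ in 𝓝 t, γ τ ∈ (chartAt E p).source ∧ MDiffAt γ τ := by
  filter_upwards [hγ.continuousAt ((chartAt E p).open_source.mem_nhds ht),
    (contMDiffAt_iff_contMDiffAt_nhds (by simp)).1 hγ] with τ h1 h2
  exact ⟨h1, h2.mdifferentiableAt (by simp)⟩

theorem components_velocity_eventuallyEq {p : M} {γ : ℝ → M} {t : ℝ}
    (ht : γ t ∈ (chartAt E p).source) (hγ : ContMDiffAt 𝓘(ℝ, ℝ) 𝓘(ℝ, E) 2 γ t) :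
    (fun τ ↦ components p (γ τ) (velocity (E := E) γ τ)) =ᶠ[𝓝 t]
      deriv (fun τ ↦ extChartAt 𝓘(ℝ, E) p (γ τ)) := by
  filter_upwards [eventually_mem_and_mdifferentiableAt ht hγ] with τ h
  exact (hasDerivAt_extChartAt_comp h.1 h.2).deriv.symm

theorem contDiffAt_components_velocity {p : M} {γ : ℝ → M} {t : ℝ}
    (ht : γ t ∈ (chartAt E p).source) (hγ : ContMDiffAt 𝓘(ℝ, ℝ) 𝓘(ℝ, E) 2 γ t) :
    ContDiffAt ℝ 1 (fun τ ↦ components p (γ τ) (velocity (E := E) γ τ)) t :=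
  (((contDiffAt_extChartAt_comp ht hγ).fderiv_right (m := 1) (by norm_num)).clm_apply
    contDiffAt_const).congr_of_eventuallyEq (components_velocity_eventuallyEq ht hγ)

variable [FiniteDimensional ℝ E]
  (cov : CovariantDerivative 𝓘(ℝ, E) E (fun x : M ↦ TangentSpace 𝓘(ℝ, E) x))

/-- The acceleration of a curve, in components with respect to an arbitrary preferred chart. -/
theorem components_covAlong_velocity {p : M} {γ : ℝ → M} {t : ℝ}
    (ht : γ t ∈ (chartAt E p).source) (hγ : ContMDiffAt 𝓘(ℝ, ℝ) 𝓘(ℝ, E) 2 γ t) :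
    components p (γ t) (covAlong cov γ (velocity (E := E) γ) t) =
      deriv (fun τ ↦ components p (γ τ) (velocity (E := E) γ τ)) t +
        christoffel cov p (γ t) (components p (γ t) (velocity (E := E) γ t))
          (components p (γ t) (velocity (E := E) γ t)) := by
  set q := γ t with hq
  have hqq : γ t ∈ (chartAt E q).source := mem_chart_source E q
  set V := fun τ ↦ components q (γ τ) (velocity (E := E) γ τ) with hV
  have hVd : HasDerivAt V (deriv V t) t :=
    ((contDiffAt_components_velocity hqq hγ).differentiableAt (by simp)).hasDerivAt
  -- `covAlong` is computed in the chart at `γ t`; `T` changes components from there to the chart at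
  -- `p`. Its derivative along `γ` appears both in the product rule for the velocity components
  -- (`hderiv`) and in the covariant derivative of the field with components frozen at `V t`
  -- (`hds`), so the two contributions agree.
  let T : M → E →L[ℝ] E := fun y ↦ ((trivializationAt E (TangentSpace 𝓘(ℝ, E)) q).coordChangeL ℝ
    (trivializationAt E (TangentSpace 𝓘(ℝ, E)) p) y : E →L[ℝ] E)
  have hT : MDiffAt T q := mdifferentiableAt_coordChangeL hqq ht
  have hTapply {y : M} (h1 : y ∈ (chartAt E q).source) (h2 : y ∈ (chartAt E p).source) (w : E) :
      T y w = components p y (coordField q w y) := by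
    refine ((trivializationAt E (TangentSpace 𝓘(ℝ, E)) q).coordChangeL_apply
      (trivializationAt E (TangentSpace 𝓘(ℝ, E)) p) ⟨h1, h2⟩ w).trans ?_
    rw [coordField, Bundle.Trivialization.symmL_apply _ h1]
    rfl
  have hγd : MDiffAt γ t := hγ.mdifferentiableAt (by simp)
  have hTγ : MDiffAt (T ∘ γ) t := hT.comp t hγd
  have hTd : HasDerivAt (T ∘ γ) (deriv (T ∘ γ) t) t := hTγ.differentiableAt.hasDerivAt
  have hnear := (eventually_mem_and_mdifferentiableAt ht hγ).and
    (eventually_mem_and_mdifferentiableAt hqq hγ)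
  have hVp : (fun τ ↦ components p (γ τ) (velocity (E := E) γ τ)) =ᶠ[𝓝 t] fun τ ↦ T (γ τ) (V τ) := by
    filter_upwards [hnear] with τ h
    rw [hTapply h.2.1 h.1.1, hV, coordField_components h.2.1]
  have hderiv : deriv (fun τ ↦ components p (γ τ) (velocity (E := E) γ τ)) t =
      deriv (T ∘ γ) t (V t) + T q (deriv V t) := by
    rw [hVp.deriv_eq]
    exact (hTd.clm_apply hVd).deriv
  let s : M → E := fun y ↦ T y (V t)
  have hs : MDiffAt s q := hT.clm_apply mdifferentiableAt_const
  have hsec : cov (coordField q (V t)) q = cov (fun y ↦ coordField p (s y) y) q := by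
    refine cov.isCovariantDerivativeOnUniv.congr_of_eventuallyEq
      (mdifferentiableAt_coordField hqq mdifferentiableAt_const)
      (mdifferentiableAt_coordField ht hs) univ_mem ?_
    filter_upwards [(chartAt E q).open_source.mem_nhds hqq,
      (chartAt E p).open_source.mem_nhds ht] with y h1 h2
    rw [show s y = T y (V t) from rfl, hTapply h1 h2, coordField_components h2]
  have hds : d% s q (velocity (E := E) γ t) = deriv (T ∘ γ) t (V t) := by
    have h1 : HasDerivAt (fun τ ↦ (T ∘ γ) τ (V t)) (deriv (T ∘ γ) t (V t)) t := by
      simpa using hTd.clm_apply (hasDerivAt_const t (V t))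
    let A : ℝ →L[ℝ] E := (mfderiv% s q).comp (mfderiv% γ t)
    have h2 : HasFDerivAt (s ∘ γ) A t :=
      (hs.hasMFDerivAt.comp t hγd.hasMFDerivAt).hasFDerivAt
    exact h2.hasDerivAt.unique h1
  have hsq : s q = components p q (velocity (E := E) γ t) := by
    rw [show s q = T q (V t) from rfl, hTapply hqq ht, hV]
    exact congrArg _ (coordField_components hqq _)
  have hcov : covAlong cov γ (velocity (E := E) γ) t =
    coordField q (deriv V t) q + cov (coordField q (V t)) q (velocity (E := E) γ t) := rfl
  rw [hcov, components_add ht, hsec, components_cov_coordField cov ht hs, hds, ← hTapply hqq ht,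
    hderiv, hsq]
  abel

theorem covAlong_velocity_eq_zero_iff {p : M} {γ : ℝ → M} {t : ℝ}
    (ht : γ t ∈ (chartAt E p).source) (hγ : ContMDiffAt 𝓘(ℝ, ℝ) 𝓘(ℝ, E) 2 γ t) :
    covAlong cov γ (velocity (E := E) γ) t = 0 ↔
      deriv (fun τ ↦ components p (γ τ) (velocity (E := E) γ τ)) t =
        -christoffel cov p (γ t) (components p (γ t) (velocity (E := E) γ t))
          (components p (γ t) (velocity (E := E) γ t)) := by
  rw [← components_eq_zero_iff ht, components_covAlong_velocity cov ht hγ, add_eq_zero_iff_eq_neg]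

end Charts

/-! ### Grönwall's inequality with respect to arc length -/

section Gronwall

open scoped RealInnerProductSpace in
-- Since `|(‖u‖²)'| ≤ 2 K l ‖u‖²`, the function `‖u‖² exp(-2KL)` is nonincreasing and `‖u‖²
-- exp(2KL)` is nondecreasing; they settle `s ≤ t` and `t ≤ s`. The square keeps the norm
-- differentiable at zeros of `u`.
theorem sq_norm_le_of_norm_deriv_le {H : Type*} [NormedAddCommGroup H] [InnerProductSpace ℝ H]
    {I : Set ℝ} (hI : Convex ℝ I) {u u' : ℝ → H} {L l : ℝ → ℝ} {K : ℝ} (hK : 0 ≤ K)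
    (hu : ∀ t ∈ I, HasDerivAt u (u' t) t) (hL : ∀ t ∈ I, HasDerivAt L (l t) t)
    (h : ∀ t ∈ I, ‖u' t‖ ≤ K * l t * ‖u t‖) {s t : ℝ} (hs : s ∈ I) (ht : t ∈ I) :
    ‖u t‖ ^ 2 ≤ ‖u s‖ ^ 2 * Real.exp (2 * K * |L t - L s|) := by
  have key (c : ℝ) (τ : ℝ) (hτ : τ ∈ I) :
      HasDerivAt (fun τ ↦ ‖u τ‖ ^ 2 * Real.exp (c * L τ))
        ((2 * ⟪u τ, u' τ⟫ + c * l τ * ‖u τ‖ ^ 2) * Real.exp (c * L τ)) τ := by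
    exact ((hu τ hτ).norm_sq.mul ((hL τ hτ).const_mul c).exp).congr_deriv (by ring)
  have hcont (c : ℝ) : ContinuousOn (fun τ ↦ ‖u τ‖ ^ 2 * Real.exp (c * L τ)) I :=
    fun τ hτ ↦ (key c τ hτ).continuousAt.continuousWithinAt
  have hin (τ : ℝ) (hτ : τ ∈ I) : |2 * ⟪u τ, u' τ⟫| ≤ 2 * K * l τ * ‖u τ‖ ^ 2 := by
    have h1 := abs_real_inner_le_norm (u τ) (u' τ)
    have h2 := mul_le_mul_of_nonneg_left (h τ hτ) (norm_nonneg (u τ))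
    rw [abs_mul, abs_two]
    nlinarith
  rcases le_total s t with hst | hst
  · have hanti : AntitoneOn (fun τ ↦ ‖u τ‖ ^ 2 * Real.exp (-(2 * K) * L τ)) I := by
      refine antitoneOn_of_deriv_nonpos hI (hcont _)
        (fun τ hτ ↦ (key _ τ (interior_subset hτ)).differentiableAt.differentiableWithinAt)
        fun τ hτ ↦ ?_
      rw [(key _ τ (interior_subset hτ)).deriv]
      have := (abs_le.1 (hin τ (interior_subset hτ))).2
      exact mul_nonpos_of_nonpos_of_nonneg (by linarith) (Real.exp_pos _).le
    have h1 := hanti hs ht hst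
    calc ‖u t‖ ^ 2 = ‖u t‖ ^ 2 * Real.exp (-(2 * K) * L t) * Real.exp (2 * K * L t) := by
          rw [mul_assoc, ← Real.exp_add]; simp
      _ ≤ ‖u s‖ ^ 2 * Real.exp (-(2 * K) * L s) * Real.exp (2 * K * L t) := by gcongr
      _ = ‖u s‖ ^ 2 * Real.exp (2 * K * (L t - L s)) := by
          rw [mul_assoc, ← Real.exp_add]; ring_nf
      _ ≤ _ := by gcongr; exact le_abs_self _
  · have hmono : MonotoneOn (fun τ ↦ ‖u τ‖ ^ 2 * Real.exp (2 * K * L τ)) I := by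
      refine monotoneOn_of_deriv_nonneg hI (hcont _)
        (fun τ hτ ↦ (key _ τ (interior_subset hτ)).differentiableAt.differentiableWithinAt)
        fun τ hτ ↦ ?_
      rw [(key _ τ (interior_subset hτ)).deriv]
      have := (abs_le.1 (hin τ (interior_subset hτ))).1
      exact mul_nonneg (by linarith) (Real.exp_pos _).le
    have h1 := hmono ht hs hst
    calc ‖u t‖ ^ 2 = ‖u t‖ ^ 2 * Real.exp (2 * K * L t) * Real.exp (-(2 * K) * L t) := by
          rw [mul_assoc, ← Real.exp_add]; simp
      _ ≤ ‖u s‖ ^ 2 * Real.exp (2 * K * L s) * Real.exp (-(2 * K) * L t) := by gcongr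
      _ = ‖u s‖ ^ 2 * Real.exp (2 * K * (-(L t - L s))) := by
          rw [mul_assoc, ← Real.exp_add]; ring_nf
      _ ≤ _ := by gcongr; exact neg_le_abs _

/-- A two-sided Grönwall inequality in which the growth rate is measured by a function `L`. -/
theorem exists_norm_le_exp_of_norm_deriv_le {E : Type*} [NormedAddCommGroup E] [NormedSpace ℝ E]
    [FiniteDimensional ℝ E]
    {I : Set ℝ} (hI : Convex ℝ I) {w w' : ℝ → E} {L l : ℝ → ℝ} {K : ℝ} (hK : 0 ≤ K)
    (hw : ∀ t ∈ I, HasDerivAt w (w' t) t) (hL : ∀ t ∈ I, HasDerivAt L (l t) t)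
    (hl : ∀ t ∈ I, 0 ≤ l t)
    (h : ∀ t ∈ I, ‖w' t‖ ≤ K * l t * ‖w t‖) :
    ∃ C > 0, ∃ k ≥ 0, ∀ s ∈ I, ∀ t ∈ I, ‖w t‖ ≤ C * ‖w s‖ * Real.exp (k * |L t - L s|) := by
  -- The norm of `E` need not come from an inner product. The comparison with a Euclidean norm costs
  -- the factors `a` and `b`; the summand `1` makes them positive even when `E` is trivial.
  let e := toEuclidean (E := E)
  set a := ‖(e : E →L[ℝ] EuclideanSpace ℝ (Fin (finrank ℝ E)))‖ + 1
  set b := ‖(e.symm : EuclideanSpace ℝ (Fin (finrank ℝ E)) →L[ℝ] E)‖ + 1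
  have ha : 0 < a := by positivity
  have hb : 0 < b := by positivity
  have hae (x : E) : ‖e x‖ ≤ a * ‖x‖ :=
    ((e : E →L[ℝ] EuclideanSpace ℝ (Fin (finrank ℝ E))).le_opNorm x).trans
      (by gcongr; simp [a])
  have hbe (x : E) : ‖x‖ ≤ b * ‖e x‖ := by
    have := (e.symm : EuclideanSpace ℝ (Fin (finrank ℝ E)) →L[ℝ] E).le_opNorm (e x)
    simp only [ContinuousLinearEquiv.coe_coe, e.symm_apply_apply] at this
    exact this.trans (by gcongr; simp [b])
  refine ⟨b * a, by positivity, a * K * b, by positivity, fun s hs t ht ↦ ?_⟩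
  have hmain := sq_norm_le_of_norm_deriv_le hI (u := fun τ ↦ e (w τ)) (u' := fun τ ↦ e (w' τ))
    (K := a * K * b) (by positivity)
    (fun τ hτ ↦ e.toContinuousLinearMap.hasFDerivAt.comp_hasDerivAt τ (hw τ hτ)) hL
    (fun τ hτ ↦ by
      have h0 := hl τ hτ
      calc ‖e (w' τ)‖ ≤ a * (K * l τ * (b * ‖e (w τ)‖)) :=
            (hae _).trans (by gcongr; exact (h τ hτ).trans (by gcongr; exact hbe _))
        _ = _ := by ring) hs ht
  have hsq : ‖e (w t)‖ ≤ ‖e (w s)‖ * Real.exp (a * K * b * |L t - L s|) := by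
    refine le_of_sq_le_sq (hmain.trans_eq ?_) (by positivity)
    rw [mul_pow, ← Real.exp_nat_mul]
    congr 2
    push_cast
    ring
  calc ‖w t‖ ≤ b * (‖e (w s)‖ * Real.exp (a * K * b * |L t - L s|)) :=
        (hbe _).trans (by gcongr)
    _ ≤ b * (a * ‖w s‖ * Real.exp (a * K * b * |L t - L s|)) := by gcongr; exact hae _
    _ = _ := by ring

end Gronwall

/-! ### Local bounds and the geodesic vector field -/

section GeodesicEquation

variable {E : Type*} [NormedAddCommGroup E] [NormedSpace ℝ E]
  {M : Type*} [TopologicalSpace M] [ChartedSpace E M] [IsManifold 𝓘(ℝ, E) ∞ M]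

omit [IsManifold 𝓘(ℝ, E) ∞ M] in
-- The ascriptions to `E` allow comparing vectors whose tangent spaces, at `γ t` and `γ' t`, are
-- syntactically different types.
theorem velocity_congr {γ γ' : ℝ → M} {t : ℝ} (h : γ =ᶠ[𝓝 t] γ') :
    (velocity (E := E) γ t : E) = (velocity (E := E) γ' t : E) :=
  congrArg (fun A : ℝ →L[ℝ] E ↦ A 1) h.mfderiv_eq

theorem covAlong_velocity_congr
    (cov : CovariantDerivative 𝓘(ℝ, E) E (fun x : M ↦ TangentSpace 𝓘(ℝ, E) x))
    {γ γ' : ℝ → M} {t : ℝ} (h : γ =ᶠ[𝓝 t] γ') :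
    (covAlong cov γ (velocity γ) t : E) = (covAlong cov γ' (velocity γ') t : E) := by
  -- `f` and `c` are nondependent in their vector arguments, so base points can be rewritten.
  let f (q : M) (a b v : E) : E := coordField q a q + cov (coordField q b) q v
  let c (q x : M) (v : E) : E := components q x v
  have hf (γ : ℝ → M) : (covAlong cov γ (velocity γ) t : E) =
      f (γ t) (deriv (fun τ ↦ c (γ t) (γ τ) (velocity (E := E) γ τ)) t)
        (c (γ t) (γ t) (velocity (E := E) γ t)) (velocity (E := E) γ t) := rfl
  have hc : (fun τ ↦ c (γ t) (γ τ) (velocity (E := E) γ τ)) =ᶠ[𝓝 t]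
      fun τ ↦ c (γ t) (γ' τ) (velocity (E := E) γ' τ) := by
    filter_upwards [h.eventuallyEq_nhds] with τ hτ
    rw [hτ.eq_of_nhds, velocity_congr hτ]
  rw [hf, hf, hc.deriv_eq, h.eq_of_nhds, velocity_congr h]

theorem exists_eventually_norm_components_le
    [Bundle.RiemannianBundle (fun x : M ↦ TangentSpace 𝓘(ℝ, E) x)]
    [IsContinuousRiemannianBundle E (fun x : M ↦ TangentSpace 𝓘(ℝ, E) x)] (p : M) :
    ∃ C > 0, ∀ᶠ x in 𝓝 p, ∀ v : TangentSpace 𝓘(ℝ, E) x, ‖components p x v‖ ≤ C * ‖v‖ := by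
  obtain ⟨C, hC, h⟩ :=
    eventually_norm_trivializationAt_lt E (fun x : M ↦ TangentSpace 𝓘(ℝ, E) x) p
  refine ⟨C, hC, ?_⟩
  filter_upwards [h, chart_source_mem_nhds E p] with x hx hxs v
  rw [components_eq_continuousLinearMapAt hxs]
  exact (ContinuousLinearMap.le_opNorm _ v).trans (by gcongr)

variable [FiniteDimensional ℝ E] [T2Space M]
  (cov : CovariantDerivative 𝓘(ℝ, E) E (fun x : M ↦ TangentSpace 𝓘(ℝ, E) x))
  [cov.ContMDiffCovariantDerivative ∞]

theorem exists_eventually_norm_christoffel_le (p : M) :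
    ∃ C > 0, ∀ᶠ x in 𝓝 p, ∀ w : E, ‖christoffel cov p x w w‖ ≤ C * ‖w‖ * ‖w‖ := by
  set b := finBasis ℝ E
  let l (i) : E →L[ℝ] ℝ := LinearMap.toContinuousLinearMap (b.coord i)
  have hG (i j) : ∀ᶠ x in 𝓝 p,
      ‖christoffelSymbol cov p i j x‖ < ‖christoffelSymbol cov p i j p‖ + 1 :=
    (contMDiffAt_christoffelSymbol cov (mem_chart_source E p) i j).continuousAt.norm.eventually_lt
      continuousAt_const (by simp)
  refine ⟨(∑ i, ∑ j, ‖l i‖ * ‖l j‖ * (‖christoffelSymbol cov p i j p‖ + 1)) + 1, by positivity, ?_⟩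
  filter_upwards [eventually_all.2 fun i ↦ eventually_all.2 (hG i)] with x hx w
  have h1 (i) : |b.repr w i| ≤ ‖l i‖ * ‖w‖ := (l i).le_opNorm w
  calc ‖christoffel cov p x w w‖
      ≤ ∑ i, ∑ j, (‖l i‖ * ‖w‖) * (‖l j‖ * ‖w‖) * (‖christoffelSymbol cov p i j p‖ + 1) := by
        refine (norm_sum_le _ _).trans (Finset.sum_le_sum fun i _ ↦ (norm_sum_le _ _).trans
          (Finset.sum_le_sum fun j _ ↦ ?_))
        rw [norm_smul, norm_mul]
        gcongr
        · exact h1 i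
        · exact h1 j
        · exact (hx i j).le
    _ = (∑ i, ∑ j, ‖l i‖ * ‖l j‖ * (‖christoffelSymbol cov p i j p‖ + 1)) * (‖w‖ * ‖w‖) := by
        simp only [Finset.sum_mul]
        exact Finset.sum_congr rfl fun i _ ↦ Finset.sum_congr rfl fun j _ ↦ by ring
    _ ≤ _ := by nlinarith [mul_self_nonneg ‖w‖]

/-- The geodesic equation in the preferred chart at `p`, as a vector field on `E × E`. -/
noncomputable def geodesicField (p : M) (z : E × E) : E × E :=
  (z.2, -christoffel cov p ((extChartAt 𝓘(ℝ, E) p).symm z.1) z.2 z.2)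

theorem contDiffAt_geodesicField {p : M} {z : E × E} (hz : z.1 ∈ (extChartAt 𝓘(ℝ, E) p).target) :
    ContDiffAt ℝ ∞ (geodesicField cov p) z := by
  set b := finBasis ℝ E
  let l (i) : E →L[ℝ] ℝ := LinearMap.toContinuousLinearMap (b.coord i)
  have hl (i) : ContDiffAt ℝ ∞ (fun z : E × E ↦ b.repr z.2 i) z :=
    (l i).contDiff.contDiffAt.comp z contDiffAt_snd
  have hG (i j) : ContDiffAt ℝ ∞
      (fun z : E × E ↦ christoffelSymbol cov p i j ((extChartAt 𝓘(ℝ, E) p).symm z.1)) z := by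
    have hx : (extChartAt 𝓘(ℝ, E) p).symm z.1 ∈ (chartAt E p).source := by
      simpa using (extChartAt 𝓘(ℝ, E) p).map_target hz
    have h1 := (contMDiffAt_christoffelSymbol cov hx i j)
    have h2 : ContMDiffAt 𝓘(ℝ, E) 𝓘(ℝ, E) ∞ (extChartAt 𝓘(ℝ, E) p).symm z.1 :=
      (contMDiffOn_extChartAt_symm p).contMDiffAt
        ((isOpen_extChartAt_target p).mem_nhds hz)
    exact (h1.comp z.1 h2).contDiffAt.comp z contDiffAt_fst
  refine contDiffAt_snd.prodMk (ContDiffAt.neg ?_)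
  exact ContDiffAt.sum fun i _ ↦ ContDiffAt.sum fun j _ ↦ ((hl i).mul (hl j)).smul (hG i j)

end GeodesicEquation

/-! ### Continuing a convergent ODE solution -/

section OrdinaryDifferentialEquations

/-- The solution is glued at `T` to the Picard–Lindelöf solution starting from its limit `z₀`. -/
theorem exists_ode_extension {V : Type*} [NormedAddCommGroup V] [NormedSpace ℝ V] [CompleteSpace V]
    {F : V → V} {z₀ : V} (hF : ContDiffAt ℝ 1 F z₀) {z : ℝ → V} {a T : ℝ} (haT : a < T)
    (hz : ∀ t ∈ Ioo a T, HasDerivAt z (F (z t)) t) (hlim : Tendsto z (𝓝[<] T) (𝓝 z₀)) :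
    ∃ Z : ℝ → V, ∃ ε > 0, EqOn Z z (Iio T) ∧ Z T = z₀ ∧
      ∀ t ∈ Ioo a (T + ε), HasDerivAt Z (F (Z t)) t := by
  obtain ⟨α, hα0, ε, hε, hα⟩ :=
    hF.exists_forall_mem_closedBall_exists_eq_forall_mem_Ioo_hasDerivAt₀ T
  classical
  let Z : ℝ → V := fun t ↦ if t < T then z t else α t
  have hZl : EqOn Z z (Iio T) := fun t ht ↦ if_pos ht
  have hZr : EqOn Z α (Ici T) := fun t ht ↦ if_neg (not_lt.2 ht)
  have hZT : Z T = z₀ := (hZr self_mem_Ici).trans hα0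
  refine ⟨Z, ε, hε, hZl, hZT, fun t ht ↦ ?_⟩
  have hleft (s) (hs : s ∈ Ioo a T) : HasDerivAt Z (F (Z s)) s := by
    rw [hZl hs.2]
    exact (hz s hs).congr_of_eventuallyEq
      (eventuallyEq_of_mem (Iio_mem_nhds hs.2) hZl)
  rcases lt_trichotomy t T with h | rfl | h
  · exact hleft t ⟨ht.1, h⟩
  · have hIoo : Ioo a t ∈ 𝓝[<] t := Ioo_mem_nhdsLT haT
    have hZlim : Tendsto Z (𝓝[<] t) (𝓝 z₀) :=
      hlim.congr' (eventuallyEq_of_mem self_mem_nhdsWithin fun s hs ↦ (hZl hs).symm)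
    -- At the junction the left derivative exists because the derivatives `F (z s)` converge to `F
    -- z₀`.
    have h1 : HasDerivWithinAt Z (F (Z t)) (Iic t) t := by
      refine hasDerivWithinAt_Iic_of_tendsto_deriv (s := Ioo a t)
        (fun s hs ↦ (hleft s hs).differentiableAt.differentiableWithinAt) ?_ hIoo ?_
      · rw [ContinuousWithinAt, hZT]
        exact hZlim.mono_left (nhdsWithin_mono _ fun s hs ↦ hs.2)
      · rw [hZT]
        refine (hF.continuousAt.tendsto.comp hZlim).congr' ?_
        filter_upwards [hIoo] with s hs
        exact (hleft s hs).deriv.symm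
    have h2 : HasDerivWithinAt Z (F (Z t)) (Ici t) t := by
      rw [hZr self_mem_Ici]
      exact (hα t ⟨by linarith, by linarith⟩).hasDerivWithinAt.congr hZr (hZr self_mem_Ici)
    have h3 := h1.union h2
    rwa [Iic_union_Ici, hasDerivWithinAt_univ] at h3
  · rw [hZr h.le]
    exact (hα t ⟨by linarith, ht.2⟩).congr_of_eventuallyEq
      (eventuallyEq_of_mem (Ioi_mem_nhds h) fun s hs ↦ hZr (mem_Ici.2 (le_of_lt hs)))

/-- Bootstrapping: `deriv Z = F ∘ Z` inherits the regularity of `Z`, from `C⁰` to `C¹`. -/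
theorem contDiffOn_two_of_hasDerivAt {V : Type*} [NormedAddCommGroup V] [NormedSpace ℝ V]
    {F : V → V} {Z : ℝ → V} {O : Set ℝ} (hO : IsOpen O)
    (hF : ∀ t ∈ O, ContDiffAt ℝ 1 F (Z t)) (hZ : ∀ t ∈ O, HasDerivAt Z (F (Z t)) t) :
    ContDiffOn ℝ 2 Z O := by
  have hd : DifferentiableOn ℝ Z O := fun t ht ↦
    (hZ t ht).differentiableAt.differentiableWithinAt
  have hderiv : EqOn (deriv Z) (F ∘ Z) O := fun t ht ↦ (hZ t ht).deriv
  have h1 : ContDiffOn ℝ (0 + 1) Z O := by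
    rw [contDiffOn_succ_iff_deriv_of_isOpen hO]
    refine ⟨hd, by simp, contDiffOn_zero.2 (ContinuousOn.congr (fun t ht ↦ ?_) hderiv)⟩
    exact ((hF t ht).continuousAt.comp (hZ t ht).continuousAt).continuousWithinAt
  rw [zero_add] at h1
  have h2 : ContDiffOn ℝ (1 + 1) Z O := by
    rw [contDiffOn_succ_iff_deriv_of_isOpen hO]
    exact ⟨hd, by simp, ContDiffOn.congr
      (fun t ht ↦ (hF t ht).comp_contDiffWithinAt t (h1 t ht)) hderiv⟩
  rwa [one_add_one_eq_two] at h2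

end OrdinaryDifferentialEquations

/-! ### Geodesics as integral curves -/

section GeodesicEquation

variable {E : Type*} [NormedAddCommGroup E] [NormedSpace ℝ E] [FiniteDimensional ℝ E]
  {M : Type*} [TopologicalSpace M] [ChartedSpace E M] [IsManifold 𝓘(ℝ, E) ∞ M] [T2Space M]
  (cov : CovariantDerivative 𝓘(ℝ, E) E (fun x : M ↦ TangentSpace 𝓘(ℝ, E) x))
  [cov.ContMDiffCovariantDerivative ∞]

/-- Integral curves of the geodesic field project to geodesics. -/
theorem geodesic_of_hasDerivAt_geodesicField {p : M} {Z : ℝ → E × E} {O : Set ℝ} (hO : IsOpen O)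
    (hZt : ∀ t ∈ O, (Z t).1 ∈ (extChartAt 𝓘(ℝ, E) p).target)
    (hZ : ∀ t ∈ O, HasDerivAt Z (geodesicField cov p (Z t)) t)
    {γ : ℝ → M} (hγ : ∀ t ∈ O, γ t = (extChartAt 𝓘(ℝ, E) p).symm (Z t).1) {t : ℝ} (ht : t ∈ O) :
    ContMDiffAt 𝓘(ℝ, ℝ) 𝓘(ℝ, E) 2 γ t ∧ covAlong cov γ (velocity γ) t = 0 := by
  have hZ2 := contDiffOn_two_of_hasDerivAt hO
    (fun t ht ↦ (contDiffAt_geodesicField cov (hZt t ht)).of_le (by norm_cast)) hZ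
  have hsmooth (t) (ht : t ∈ O) : ContMDiffAt 𝓘(ℝ, ℝ) 𝓘(ℝ, E) 2 γ t := by
    have h1 : ContMDiffAt 𝓘(ℝ, E) 𝓘(ℝ, E) 2 (extChartAt 𝓘(ℝ, E) p).symm (Z t).1 :=
      ((contMDiffOn_extChartAt_symm (n := ∞) p).contMDiffAt
        ((isOpen_extChartAt_target p).mem_nhds (hZt t ht))).of_le (by norm_cast)
    have h2 : ContDiffAt ℝ 2 (fun τ ↦ (Z τ).1) t :=
      contDiffAt_fst.comp t (hZ2.contDiffAt (hO.mem_nhds ht))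
    exact (h1.comp t h2.contMDiffAt).congr_of_eventuallyEq
      (eventuallyEq_of_mem (hO.mem_nhds ht) hγ)
  have hsource (t) (ht : t ∈ O) : γ t ∈ (chartAt E p).source := by
    rw [hγ t ht]
    simpa using (extChartAt 𝓘(ℝ, E) p).map_target (hZt t ht)
  have hchart (t) (ht : t ∈ O) : extChartAt 𝓘(ℝ, E) p (γ t) = (Z t).1 := by
    rw [hγ t ht, (extChartAt 𝓘(ℝ, E) p).right_inv (hZt t ht)]
  have hvel (t) (ht : t ∈ O) : components p (γ t) (velocity (E := E) γ t) = (Z t).2 := by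
    have h1 := hasDerivAt_extChartAt_comp (hsource t ht)
      ((hsmooth t ht).mdifferentiableAt (by simp))
    have h2 : HasDerivAt (fun τ ↦ (Z τ).1) (Z t).2 t :=
      (hZ t ht).fst
    exact h1.unique (h2.congr_of_eventuallyEq (eventuallyEq_of_mem (hO.mem_nhds ht) hchart))
  refine ⟨hsmooth t ht, (covAlong_velocity_eq_zero_iff cov (hsource t ht) (hsmooth t ht)).2 ?_⟩
  have h2 : HasDerivAt (fun τ ↦ (Z τ).2) (geodesicField cov p (Z t)).2 t :=
    (hZ t ht).snd
  rw [(eventuallyEq_of_mem (hO.mem_nhds ht) hvel).deriv_eq, h2.deriv, hvel t ht, geodesicField,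
    ← hγ t ht]

variable {cov}

namespace IsGeodesicOn

variable {γ : ℝ → M} {J : Set ℝ}

omit [FiniteDimensional ℝ E] [T2Space M] [cov.ContMDiffCovariantDerivative ∞] in
theorem contMDiffAt (h : IsGeodesicOn cov γ J) {t : ℝ} (ht : t ∈ J) :
    ContMDiffAt 𝓘(ℝ, ℝ) 𝓘(ℝ, E) 2 γ t :=
  h.contMDiffOn.contMDiffAt (h.isOpen.mem_nhds ht)

omit [FiniteDimensional ℝ E] [T2Space M] [cov.ContMDiffCovariantDerivative ∞] in
theorem mdifferentiableAt (h : IsGeodesicOn cov γ J) {t : ℝ} (ht : t ∈ J) : MDiffAt γ t :=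
  (h.contMDiffAt ht).mdifferentiableAt (by simp)

omit [FiniteDimensional ℝ E] [T2Space M] [cov.ContMDiffCovariantDerivative ∞] in
theorem ordConnected (h : IsGeodesicOn cov γ J) : J.OrdConnected :=
  h.isConnected.isPreconnected.ordConnected

omit [T2Space M] [cov.ContMDiffCovariantDerivative ∞] in
theorem hasDerivAt_components_velocity (h : IsGeodesicOn cov γ J) {p : M} {t : ℝ} (ht : t ∈ J)
    (hp : γ t ∈ (chartAt E p).source) :
    HasDerivAt (fun τ ↦ components p (γ τ) (velocity (E := E) γ τ))
      (-christoffel cov p (γ t) (components p (γ t) (velocity (E := E) γ t))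
        (components p (γ t) (velocity (E := E) γ t))) t := by
  rw [← (covAlong_velocity_eq_zero_iff cov hp (h.contMDiffAt ht)).1 (h.covAlong_eq_zero t ht)]
  exact ((contDiffAt_components_velocity hp (h.contMDiffAt ht)).differentiableAt
    (by simp)).hasDerivAt

end IsGeodesicOn

end GeodesicEquation

/-! ### Speed, arc length and distance -/

section Length

variable {E : Type*} [NormedAddCommGroup E] [NormedSpace ℝ E]
  {M : Type*} [TopologicalSpace M] [ChartedSpace E M] [IsManifold 𝓘(ℝ, E) ∞ M]
  [Bundle.RiemannianBundle (fun x : M ↦ TangentSpace 𝓘(ℝ, E) x)]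

/-- Curves of class `C²` have continuous speed. -/
theorem continuousAt_norm_velocity
    [IsContinuousRiemannianBundle E (fun x : M ↦ TangentSpace 𝓘(ℝ, E) x)]
    {γ : ℝ → M} {t : ℝ} (hγ : ContMDiffAt 𝓘(ℝ, ℝ) 𝓘(ℝ, E) 2 γ t) :
    ContinuousAt (fun τ ↦ ‖velocity (E := E) γ τ‖) t := by
  have h1 : ContinuousAt
      (fun τ ↦ (⟨γ τ, velocity γ τ⟩ : Bundle.TotalSpace E (TangentSpace 𝓘(ℝ, E) (M := M)))) t := by
    rw [FiberBundle.continuousAt_totalSpace]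
    exact ⟨hγ.continuousAt,
      (contDiffAt_components_velocity (mem_chart_source E (γ t)) hγ).continuousAt⟩
  have h2 := (ContinuousAt.inner_bundle h1 h1).sqrt
  exact h2.congr (Eventually.of_forall fun τ ↦ (norm_eq_sqrt_real_inner _).symm)

omit [IsManifold 𝓘(ℝ, E) ∞ M] [Bundle.RiemannianBundle (fun x : M ↦ TangentSpace 𝓘(ℝ, E) x)] in
theorem velocity_comp {γ : ℝ → M} {f : ℝ → ℝ} {f' s : ℝ} (hγ : MDiffAt γ (f s))
    (hf : HasDerivAt f f' s) :
    velocity (E := E) (γ ∘ f) s = f' • velocity (E := E) γ (f s) := by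
  have h1 := (hγ.hasMFDerivAt.comp s hf.hasFDerivAt.hasMFDerivAt).mfderiv
  have h2 : velocity (E := E) (γ ∘ f) s = mfderiv% γ (f s) (f' • (1 : ℝ)) := by
    rw [velocity, h1]
    simp only [smul_eq_mul, mul_one]
    refine (ContinuousLinearMap.comp_apply _ _ _).trans (congrArg _ ?_)
    exact (ContinuousLinearMap.toSpanSingleton_apply ℝ f' 1).trans (one_mul f')
  rw [h2]
  exact map_smul _ _ _

/-- A primitive of the speed of a curve. -/
noncomputable def arcLength (γ : ℝ → M) (t₀ t : ℝ) : ℝ :=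
  ∫ τ in t₀..t, ‖velocity (E := E) γ τ‖

variable [IsContinuousRiemannianBundle E (fun x : M ↦ TangentSpace 𝓘(ℝ, E) x)]
  {γ : ℝ → M} {J : Set ℝ}

theorem continuousOn_norm_velocity (hγ : ContMDiffOn 𝓘(ℝ, ℝ) 𝓘(ℝ, E) 2 γ J) (hJ : IsOpen J) :
    ContinuousOn (fun τ ↦ ‖velocity (E := E) γ τ‖) J := fun _ ht ↦
  (continuousAt_norm_velocity (hγ.contMDiffAt (hJ.mem_nhds ht))).continuousWithinAt

theorem intervalIntegrable_norm_velocity (hγ : ContMDiffOn 𝓘(ℝ, ℝ) 𝓘(ℝ, E) 2 γ J) (hJ : IsOpen J)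
    (hJc : J.OrdConnected) {s t : ℝ} (hs : s ∈ J) (ht : t ∈ J) :
    IntervalIntegrable (fun τ ↦ ‖velocity (E := E) γ τ‖) volume s t :=
  ((continuousOn_norm_velocity hγ hJ).mono (hJc.uIcc_subset hs ht)).intervalIntegrable

theorem hasDerivAt_arcLength (hγ : ContMDiffOn 𝓘(ℝ, ℝ) 𝓘(ℝ, E) 2 γ J) (hJ : IsOpen J)
    (hJc : J.OrdConnected) {t₀ t : ℝ} (ht₀ : t₀ ∈ J) (ht : t ∈ J) :
    HasDerivAt (arcLength (E := E) γ t₀) ‖velocity (E := E) γ t‖ t :=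
  intervalIntegral.integral_hasDerivAt_right
    (intervalIntegrable_norm_velocity hγ hJ hJc ht₀ ht)
    ((continuousOn_norm_velocity hγ hJ).stronglyMeasurableAtFilter hJ t ht)
    ((continuousOn_norm_velocity hγ hJ).continuousAt (hJ.mem_nhds ht))

theorem monotoneOn_arcLength (hγ : ContMDiffOn 𝓘(ℝ, ℝ) 𝓘(ℝ, E) 2 γ J) (hJ : IsOpen J)
    (hJc : J.OrdConnected) {t₀ : ℝ} (ht₀ : t₀ ∈ J) :
    MonotoneOn (arcLength (E := E) γ t₀) J := by
  have hL (t) (ht : t ∈ J) := hasDerivAt_arcLength hγ hJ hJc ht₀ ht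
  refine monotoneOn_of_deriv_nonneg hJc.convex
    (fun t ht ↦ (hL t ht).continuousAt.continuousWithinAt)
    (fun t ht ↦ (hL t (interior_subset ht)).differentiableAt.differentiableWithinAt)
    fun t ht ↦ ?_
  rw [(hL t (interior_subset ht)).deriv]
  exact norm_nonneg _

theorem lintegral_enorm_velocity (hγ : ContMDiffOn 𝓘(ℝ, ℝ) 𝓘(ℝ, E) 2 γ J) (hJ : IsOpen J)
    (hJc : J.OrdConnected) {t₀ s t : ℝ} (ht₀ : t₀ ∈ J) (hs : s ∈ J) (ht : t ∈ J) (hst : s ≤ t) :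
    ∫⁻ τ in Icc s t, ‖velocity (E := E) γ τ‖ₑ =
      ENNReal.ofReal (arcLength (E := E) γ t₀ t - arcLength (E := E) γ t₀ s) := by
  rw [arcLength, arcLength, intervalIntegral.integral_interval_sub_left
    (intervalIntegrable_norm_velocity hγ hJ hJc ht₀ ht)
    (intervalIntegrable_norm_velocity hγ hJ hJc ht₀ hs),
    intervalIntegral.integral_of_le hst, ← integral_Icc_eq_integral_Ioc,
    ofReal_integral_eq_lintegral_ofReal]
  · simp only [ofReal_norm]
  · exact ((continuousOn_norm_velocity hγ hJ).mono (hJc.out hs ht)).integrableOn_Icc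
  · exact Eventually.of_forall fun _ ↦ norm_nonneg _

end Length

section Distance

variable {E : Type*} [NormedAddCommGroup E] [NormedSpace ℝ E]
  {M : Type*} [EMetricSpace M] [ChartedSpace E M] [IsManifold 𝓘(ℝ, E) ∞ M]
  [Bundle.RiemannianBundle (fun x : M ↦ TangentSpace 𝓘(ℝ, E) x)]
  [IsContinuousRiemannianBundle E (fun x : M ↦ TangentSpace 𝓘(ℝ, E) x)]
  [IsRiemannianManifold 𝓘(ℝ, E) M] {γ : ℝ → M} {J : Set ℝ}

theorem edist_le_arcLength_sub (hγ : ContMDiffOn 𝓘(ℝ, ℝ) 𝓘(ℝ, E) 2 γ J) (hJ : IsOpen J)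
    (hJc : J.OrdConnected) {t₀ s t : ℝ} (ht₀ : t₀ ∈ J) (hs : s ∈ J) (ht : t ∈ J) (hst : s ≤ t) :
    edist (γ s) (γ t) ≤
      ENNReal.ofReal (arcLength (E := E) γ t₀ t - arcLength (E := E) γ t₀ s) := by
  rw [← lintegral_enorm_velocity hγ hJ hJc ht₀ hs ht hst,
    IsRiemannianManifold.out (I := 𝓘(ℝ, E)) (γ s) (γ t)]
  refine (Manifold.riemannianEDist_le_pathELength
    ((hγ.mono (hJc.out hs ht)).of_le (by norm_num)) rfl rfl hst).trans_eq ?_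
  rw [Manifold.pathELength_eq_lintegral_mfderiv_Icc]
  rfl

end Distance

/-! ### Growth of the velocity of a geodesic -/

section Bounds

variable {E : Type*} [NormedAddCommGroup E] [NormedSpace ℝ E] [FiniteDimensional ℝ E]
  {M : Type*} [TopologicalSpace M] [ChartedSpace E M] [IsManifold 𝓘(ℝ, E) ∞ M] [T2Space M]
  [Bundle.RiemannianBundle (fun x : M ↦ TangentSpace 𝓘(ℝ, E) x)]
  [IsContinuousRiemannianBundle E (fun x : M ↦ TangentSpace 𝓘(ℝ, E) x)]
  {cov : CovariantDerivative 𝓘(ℝ, E) E (fun x : M ↦ TangentSpace 𝓘(ℝ, E) x)}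

/-- A set on which the preferred chart at `p` is defined, and on which the metric and the
Christoffel symbols in this chart are controlled. -/
structure IsControlled
    (cov : CovariantDerivative 𝓘(ℝ, E) E (fun x : M ↦ TangentSpace 𝓘(ℝ, E) x))
    (p : M) (D B : ℝ) (U : Set M) : Prop where
  pos_left : 0 < D
  pos_right : 0 < B
  subset_source : U ⊆ (chartAt E p).source
  norm_components_le : ∀ x ∈ U, ∀ v : TangentSpace 𝓘(ℝ, E) x, ‖components p x v‖ ≤ D * ‖v‖
  norm_christoffel_le : ∀ x ∈ U, ∀ w : E, ‖christoffel cov p x w w‖ ≤ B * ‖w‖ * ‖w‖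

variable (cov) in
theorem exists_isControlled [cov.ContMDiffCovariantDerivative ∞] (p : M) :
    ∃ U ∈ 𝓝 p, ∃ D B, IsControlled cov p D B U := by
  obtain ⟨D, hD, h1⟩ := exists_eventually_norm_components_le (E := E) p
  obtain ⟨B, hB, h2⟩ := exists_eventually_norm_christoffel_le cov p
  exact ⟨_, (h1.and h2).and (chart_source_mem_nhds E p), D, B, hD, hB, fun x hx ↦ hx.2,
    fun x hx ↦ hx.1.1, fun x hx ↦ hx.1.2⟩

omit [T2Space M] in
-- The Christoffel term is quadratic in the velocity. Bounding one factor by `D` times the speed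
-- makes it linear with rate `B * D * ‖γ'‖`, so growth is controlled by the length of the arc alone,
-- whatever its duration.
theorem IsGeodesicOn.exists_norm_components_le {γ : ℝ → M} {J : Set ℝ} (h : IsGeodesicOn cov γ J)
    {p : M} {D B : ℝ} {U : Set M} (hU : IsControlled cov p D B U) {I : Set ℝ} (hI : Convex ℝ I)
    (hIJ : I ⊆ J) (hγ : MapsTo γ I U) {t₀ : ℝ} (ht₀ : t₀ ∈ J) :
    ∃ C > 0, ∃ k ≥ 0, ∀ s ∈ I, ∀ t ∈ I,
      ‖components p (γ t) (velocity (E := E) γ t)‖ ≤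
        C * ‖components p (γ s) (velocity (E := E) γ s)‖ *
          Real.exp (k * |arcLength (E := E) γ t₀ t - arcLength (E := E) γ t₀ s|) := by
  refine exists_norm_le_exp_of_norm_deriv_le hI (K := B * D)
    (w := fun τ ↦ components p (γ τ) (velocity (E := E) γ τ))
    (l := fun τ ↦ ‖velocity (E := E) γ τ‖)
    (mul_nonneg hU.pos_right.le hU.pos_left.le)
    (fun t ht ↦ h.hasDerivAt_components_velocity (hIJ ht) (hU.subset_source (hγ ht)))
    (fun t ht ↦ hasDerivAt_arcLength h.contMDiffOn h.isOpen h.ordConnected ht₀ (hIJ ht))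
    (fun t _ ↦ norm_nonneg _) fun t ht ↦ ?_
  rw [norm_neg]
  refine (hU.norm_christoffel_le _ (hγ ht) _).trans ?_
  have h1 := hU.norm_components_le _ (hγ ht) (velocity (E := E) γ t)
  have h2 := hU.pos_right
  rw [mul_assoc B D]
  gcongr

/-- A geodesic whose velocity vanishes at some time is at rest at all times. -/
theorem IsGeodesicOn.velocity_eq_zero [cov.ContMDiffCovariantDerivative ∞] {γ : ℝ → M} {J : Set ℝ}
    (h : IsGeodesicOn cov γ J) {t₀ : ℝ} (ht₀ : t₀ ∈ J) (hv : velocity (E := E) γ t₀ = 0)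
    {t : ℝ} (ht : t ∈ J) : velocity (E := E) γ t = 0 := by
  -- Vanishing of the velocity is locally constant in time, by the two-sided growth estimate;
  -- connectedness of `J` does the rest.
  have key (t) (ht : t ∈ J) :
      ∀ᶠ s in 𝓝 t, (velocity (E := E) γ s = 0 ↔ velocity (E := E) γ t = 0) := by
    obtain ⟨U, hU, D, B, hUc⟩ := exists_isControlled cov (γ t)
    obtain ⟨ε, hε, hball⟩ := Metric.mem_nhds_iff.1
      (inter_mem (h.isOpen.mem_nhds ht) ((h.contMDiffAt ht).continuousAt hU))
    obtain ⟨C, hC, k, hk, hCk⟩ := h.exists_norm_components_le hUc (convex_ball t ε)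
      (fun s hs ↦ (hball hs).1) (fun s hs ↦ (hball hs).2) ht₀
    have hz (s) (hs : s ∈ Metric.ball t ε) (s') (hs' : s' ∈ Metric.ball t ε)
        (h0 : velocity (E := E) γ s = 0) : velocity (E := E) γ s' = 0 := by
      rw [← components_eq_zero_iff (hUc.subset_source (hball hs').2), ← norm_le_zero_iff]
      rw [← components_eq_zero_iff (hUc.subset_source (hball hs).2)] at h0
      simpa [h0] using hCk s hs s' hs'
    filter_upwards [Metric.ball_mem_nhds t hε] with s hs
    exact ⟨hz s hs t (Metric.mem_ball_self hε), hz t (Metric.mem_ball_self hε) s hs⟩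
  let Z : Set ℝ := {t | velocity (E := E) γ t = 0}
  have hsub : J ⊆ interior Z ∪ interior Zᶜ := by
    intro t ht
    by_cases h0 : velocity (E := E) γ t = 0
    · exact .inl (mem_interior_iff_mem_nhds.2 ((key t ht).mono fun s hs ↦ hs.2 h0))
    · exact .inr (mem_interior_iff_mem_nhds.2 ((key t ht).mono fun s hs h1 ↦ h0 (hs.1 h1)))
  rcases h.isConnected.isPreconnected.subset_or_subset isOpen_interior isOpen_interior
    (disjoint_compl_right.mono interior_subset interior_subset) hsub with h1 | h1
  · exact interior_subset (s := Z) (h1 ht)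
  · exact absurd hv (interior_subset (h1 ht₀))

end Bounds

/-! ### Nonvanishing velocity and convergence at finite length -/

section Complete

variable {E : Type*} [NormedAddCommGroup E] [NormedSpace ℝ E] [FiniteDimensional ℝ E]
  {M : Type*} [EMetricSpace M] [ChartedSpace E M] [IsManifold 𝓘(ℝ, E) ∞ M]
  [Bundle.RiemannianBundle (fun x : M ↦ TangentSpace 𝓘(ℝ, E) x)]
  [IsContinuousRiemannianBundle E (fun x : M ↦ TangentSpace 𝓘(ℝ, E) x)]
  [IsRiemannianManifold 𝓘(ℝ, E) M]
  {cov : CovariantDerivative 𝓘(ℝ, E) E (fun x : M ↦ TangentSpace 𝓘(ℝ, E) x)}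
  {γ : ℝ → M} {J : Set ℝ}

theorem IsGeodesicOn.velocity_ne_zero [cov.ContMDiffCovariantDerivative ∞]
    (h : IsGeodesicOn cov γ J) (hne : ∃ t₁ ∈ J, ∃ t₂ ∈ J, γ t₁ ≠ γ t₂) {t : ℝ} (ht : t ∈ J) :
    velocity (E := E) γ t ≠ 0 := by
  intro h0
  have hconst (t₁) (ht₁ : t₁ ∈ J) (t₂) (ht₂ : t₂ ∈ J) (hle : t₁ ≤ t₂) : γ t₁ = γ t₂ := by
    rw [← edist_le_zero]
    refine (edist_le_arcLength_sub h.contMDiffOn h.isOpen h.ordConnected ht ht₁ ht₂ hle).trans ?_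
    rw [← lintegral_enorm_velocity h.contMDiffOn h.isOpen h.ordConnected ht ht₁ ht₂ hle,
      setLIntegral_congr_fun (g := fun _ ↦ 0) measurableSet_Icc]
    · simp
    · intro s hs
      simp [h.velocity_eq_zero ht h0 (h.ordConnected.out ht₁ ht₂ hs)]
  obtain ⟨t₁, ht₁, t₂, ht₂, hne⟩ := hne
  rcases le_total t₁ t₂ with hle | hle
  · exact hne (hconst t₁ ht₁ t₂ ht₂ hle)
  · exact hne (hconst t₂ ht₂ t₁ ht₁ hle).symm

omit [FiniteDimensional ℝ E] in
/-- In a complete manifold, a geodesic of finite length towards the right converges. -/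
theorem IsGeodesicOn.exists_limit [CompleteSpace M] (h : IsGeodesicOn cov γ J) {t₀ : ℝ}
    (ht₀ : t₀ ∈ J) (hbdd : BddAbove (arcLength (E := E) γ t₀ '' J)) :
    ∃ p, ∀ U ∈ 𝓝 p, ∃ a ∈ J, ∀ t ∈ J, a ≤ t → γ t ∈ U := by
  have : Nonempty J := ⟨⟨t₀, ht₀⟩⟩
  let 𝓕 : Filter M := map (fun t : J ↦ γ t) atTop
  set L := arcLength (E := E) γ t₀
  have hmono : MonotoneOn L J :=
    monotoneOn_arcLength h.contMDiffOn h.isOpen h.ordConnected ht₀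
  have hcauchy : Cauchy 𝓕 := by
    rw [EMetric.cauchy_iff]
    refine ⟨NeBot.ne inferInstance, fun ε hε ↦ ?_⟩
    obtain ⟨δ, hδ, hδε⟩ := ENNReal.lt_iff_exists_nnreal_btwn.1 hε
    have hδ' : 0 < (δ : ℝ) := by exact_mod_cast hδ
    -- Beyond `a`, less than `δ` of the total arc length remains, so distances there are below `ε`.
    obtain ⟨_, ⟨a, ha, rfl⟩, hLa⟩ := exists_lt_of_lt_csSup (⟨_, t₀, ht₀, rfl⟩ : (L '' J).Nonempty)
      (sub_lt_self (sSup (L '' J)) hδ')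
    have hclose (s) (hs : s ∈ J) (has : a ≤ s) (t) (ht : t ∈ J) (hst : s ≤ t) :
        edist (γ s) (γ t) < ε := by
      refine (edist_le_arcLength_sub h.contMDiffOn h.isOpen h.ordConnected ht₀ hs ht hst).trans_lt
        (lt_of_le_of_lt ?_ hδε)
      refine ENNReal.ofReal_le_of_le_toReal ?_
      have h1 : L t ≤ sSup (L '' J) := le_csSup hbdd ⟨t, ht, rfl⟩
      have h2 : L a ≤ L s := hmono ha hs has
      simp only [ENNReal.coe_toReal]
      linarith
    refine ⟨(fun t : J ↦ γ t) '' Ici ⟨a, ha⟩, image_mem_map (Ici_mem_atTop _), ?_⟩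
    rintro _ ⟨⟨s, hs⟩, has, rfl⟩ _ ⟨⟨t, ht⟩, hat, rfl⟩
    rcases le_total s t with hst | hst
    · exact hclose s hs has t ht hst
    · rw [edist_comm]
      exact hclose t ht hat s hs hst
  obtain ⟨p, hp⟩ := CompleteSpace.complete hcauchy
  refine ⟨p, fun U hU ↦ ?_⟩
  obtain ⟨⟨a, ha⟩, h1⟩ := mem_atTop_sets.1 (mem_map.1 (hp hU))
  exact ⟨a, ha, fun t ht hat ↦ h1 ⟨t, ht⟩ hat⟩

end Complete

/-! ### Extending a geodesic past an end point -/

section Extension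

variable {E : Type*} [NormedAddCommGroup E] [NormedSpace ℝ E] [FiniteDimensional ℝ E]

/-- A bounded derivative makes `w` Lipschitz, hence uniformly continuous, and it maps the Cauchy
filter `𝓝[<] T` to a Cauchy filter. -/
theorem exists_tendsto_nhdsLT_of_norm_deriv_le {w w' : ℝ → E} {a T C : ℝ} (haT : a < T)
    (hw : ∀ t ∈ Ico a T, HasDerivAt w (w' t) t) (hC : ∀ t ∈ Ico a T, ‖w' t‖ ≤ C) :
    ∃ v, Tendsto w (𝓝[<] T) (𝓝 v) := by
  have : CompleteSpace E := FiniteDimensional.complete ℝ E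
  have hlip := (convex_Ico a T).lipschitzOnWith_of_nnnorm_hasDerivWithin_le (C := C.toNNReal)
    (fun t ht ↦ (hw t ht).hasDerivWithinAt) fun t ht ↦ by
      rw [← NNReal.coe_le_coe, coe_nnnorm]
      exact (hC t ht).trans (Real.le_coe_toNNReal C)
  have hle : 𝓝[<] T ≤ 𝓟 (Ico a T) := le_principal_iff.2 (Ico_mem_nhdsLT haT)
  have hc : Cauchy (𝓝[<] T) := cauchy_nhds.mono' inferInstance nhdsWithin_le_nhds
  exact CompleteSpace.complete (hc.map_of_le hlip.uniformContinuousOn hle)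

variable {M : Type*} [TopologicalSpace M] [T2Space M] [ChartedSpace E M] [IsManifold 𝓘(ℝ, E) ∞ M]
  {cov : CovariantDerivative 𝓘(ℝ, E) E (fun x : M ↦ TangentSpace 𝓘(ℝ, E) x)}
  [cov.ContMDiffCovariantDerivative ∞] {γ : ℝ → M} {J : Set ℝ}

/-- A geodesic whose velocity converges at the right end point of its interval can be extended. -/
theorem IsGeodesicOn.exists_extension (h : IsGeodesicOn cov γ J) {a T : ℝ} (haT : a < T)
    (hJ : J ∩ Ici a = Ico a T) {p : M} (hp : ∀ t ∈ Ico a T, γ t ∈ (chartAt E p).source)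
    (hlim : Tendsto γ (𝓝[<] T) (𝓝 p)) {v : E}
    (hv : Tendsto (fun t ↦ components p (γ t) (velocity (E := E) γ t)) (𝓝[<] T) (𝓝 v)) :
    ∃ γ' J', IsGeodesicOn cov γ' J' ∧ J ⊆ J' ∧ EqOn γ' γ J ∧ T ∈ J' := by
  have : CompleteSpace E := FiniteDimensional.complete ℝ E
  have hIJ : Ico a T ⊆ J := fun t ht ↦ (hJ.symm ▸ ht : t ∈ J ∩ Ici a).1
  have hJT : J ⊆ Iio T := fun t ht ↦ by
    rcases le_or_gt a t with hat | hat
    · exact (hJ ▸ (⟨ht, hat⟩ : t ∈ J ∩ Ici a) : t ∈ Ico a T).2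
    · exact hat.trans haT
  let φ := extChartAt 𝓘(ℝ, E) p
  let w : ℝ → E := fun t ↦ components p (γ t) (velocity (E := E) γ t)
  let z : ℝ → E × E := fun t ↦ (φ (γ t), w t)
  have hφs (t) (ht : t ∈ Ico a T) : γ t ∈ φ.source := by
    rw [extChartAt_source]
    exact hp t ht
  have hz (t) (ht : t ∈ Ioo a T) : HasDerivAt z (geodesicField cov p (z t)) t := by
    have ht' := Ioo_subset_Ico_self ht
    have h1 := (hasDerivAt_extChartAt_comp (hp t ht') (h.mdifferentiableAt (hIJ ht'))).prodMk
      (h.hasDerivAt_components_velocity (hIJ ht') (hp t ht'))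
    refine h1.congr_deriv ?_
    simp only [geodesicField, z]
    rw [φ.left_inv (hφs t ht')]
  have hzlim : Tendsto z (𝓝[<] T) (𝓝 (φ p, v)) :=
    ((continuousAt_extChartAt p).tendsto.comp hlim).prodMk_nhds hv
  have hφp : φ p ∈ φ.target := mem_extChartAt_target p
  obtain ⟨Z, ε, hε, hZz, hZT, hZ⟩ := exists_ode_extension
    ((contDiffAt_geodesicField cov (z := (φ p, v)) hφp).of_le (by norm_cast)) haT hz hzlim
  have hnear : ∀ᶠ t in 𝓝 T, (Z t).1 ∈ φ.target := by
    have h1 : ContinuousAt (fun t ↦ (Z t).1) T :=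
      (hZ T ⟨haT, by linarith⟩).continuousAt.fst
    refine h1 ((isOpen_extChartAt_target p).mem_nhds ?_)
    simpa only [hZT] using hφp
  obtain ⟨δ, hδ, hball⟩ := Metric.eventually_nhds_iff.1 hnear
  -- Up to `ε` beyond `T` the ODE holds; up to `δ` the solution stays in the chart. Before `T` it is
  -- `γ` itself that stays in the chart.
  set O := Ioo a (T + min ε δ)
  have hmin : 0 < min ε δ := lt_min hε hδ
  have hZt (t) (ht : t ∈ O) : (Z t).1 ∈ φ.target := by
    rcases lt_or_ge t T with htT | htT
    · rw [hZz htT]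
      exact φ.map_source (hφs t ⟨ht.1.le, htT⟩)
    · refine hball ?_
      rw [Real.dist_eq, abs_of_nonneg (by linarith)]
      linarith [ht.2, min_le_right ε δ]
  classical
  let γ' : ℝ → M := fun t ↦ if t < T then γ t else φ.symm (Z t).1
  have hγ'l : EqOn γ' γ (Iio T) := fun t ht ↦ if_pos ht
  have hγ'O (t) (ht : t ∈ O) : γ' t = φ.symm (Z t).1 := by
    rcases lt_or_ge t T with htT | htT
    · rw [hγ'l htT, hZz htT]
      exact (φ.left_inv (hφs t ⟨ht.1.le, htT⟩)).symm
    · exact if_neg (not_lt.2 htT)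
  have hgeoO (t) (ht : t ∈ O) := geodesic_of_hasDerivAt_geodesicField cov isOpen_Ioo hZt
    (fun t ht ↦ hZ t ⟨ht.1, ht.2.trans_le (by linarith [min_le_left ε δ])⟩) hγ'O ht
  have hgeoJ (t) (ht : t ∈ J) : ContMDiffAt 𝓘(ℝ, ℝ) 𝓘(ℝ, E) 2 γ' t ∧
      covAlong cov γ' (velocity γ') t = 0 := by
    have heq : γ' =ᶠ[𝓝 t] γ := eventuallyEq_of_mem (Iio_mem_nhds (hJT ht)) hγ'l
    exact ⟨(h.contMDiffAt ht).congr_of_eventuallyEq heq,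
      (covAlong_velocity_congr cov heq).trans (h.covAlong_eq_zero t ht)⟩
  have hgeo (t) (ht : t ∈ J ∪ O) := ht.elim (hgeoJ t) (hgeoO t)
  refine ⟨γ', J ∪ O, ⟨h.isOpen.union isOpen_Ioo, ?_, fun t ht ↦ (hgeo t ht).1.contMDiffWithinAt,
    fun t ht ↦ (hgeo t ht).2⟩, subset_union_left, hγ'l.mono hJT, .inr ⟨haT, by linarith⟩⟩
  obtain ⟨b, hab, hbT⟩ := exists_between haT
  exact h.isConnected.union ⟨b, hIJ ⟨hab.le, hbT⟩, hab, by linarith⟩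
    (isConnected_Ioo (by linarith))

end Extension

/-! ### Infinite length towards the right -/

section Complete

variable {E : Type*} [NormedAddCommGroup E] [NormedSpace ℝ E] [FiniteDimensional ℝ E]
  {M : Type*} [EMetricSpace M] [CompleteSpace M] [ChartedSpace E M] [IsManifold 𝓘(ℝ, E) ∞ M]
  [Bundle.RiemannianBundle (fun x : M ↦ TangentSpace 𝓘(ℝ, E) x)]
  [IsContinuousRiemannianBundle E (fun x : M ↦ TangentSpace 𝓘(ℝ, E) x)]
  [IsRiemannianManifold 𝓘(ℝ, E) M]
  {cov : CovariantDerivative 𝓘(ℝ, E) E (fun x : M ↦ TangentSpace 𝓘(ℝ, E) x)}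
  [cov.ContMDiffCovariantDerivative ∞] {γ : ℝ → M} {J : Set ℝ}

theorem IsMaximalGeodesic.not_bddAbove_arcLength (h : IsMaximalGeodesic cov γ J)
    (hne : ∃ t₁ ∈ J, ∃ t₂ ∈ J, γ t₁ ≠ γ t₂) {t₀ : ℝ} (ht₀ : t₀ ∈ J) :
    ¬ BddAbove (arcLength (E := E) γ t₀ '' J) := by
  intro hbdd
  have hg := h.isGeodesicOn
  set L := arcLength (E := E) γ t₀
  have hLd (t) (ht : t ∈ J) : HasDerivAt L ‖velocity (E := E) γ t‖ t :=
    hasDerivAt_arcLength hg.contMDiffOn hg.isOpen hg.ordConnected ht₀ ht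
  obtain ⟨p, hp⟩ := hg.exists_limit ht₀ hbdd
  obtain ⟨U, hU, D, B, hUc⟩ := exists_isControlled cov p
  obtain ⟨a, ha, haU⟩ := hp U hU
  set I := J ∩ Ici a
  have hI : Convex ℝ I := hg.ordConnected.convex.inter (convex_Ici a)
  have haI : a ∈ I := ⟨ha, self_mem_Ici⟩
  obtain ⟨C, hC, k, hk, hCk⟩ := hg.exists_norm_components_le hUc hI inter_subset_left
    (fun t ht ↦ haU t ht.1 ht.2) ht₀
  set w : ℝ → E := fun t ↦ components p (γ t) (velocity (E := E) γ t) with hw_def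
  obtain ⟨S, hS⟩ := hbdd
  have hLmono : MonotoneOn L J :=
    monotoneOn_arcLength hg.contMDiffOn hg.isOpen hg.ordConnected ht₀
  have hLS (t) (ht : t ∈ I) : |L t - L a| ≤ S - L a := by
    rw [abs_of_nonneg (sub_nonneg.2 (hLmono ha ht.1 ht.2))]
    linarith [hS ⟨t, ht.1, rfl⟩]
  -- Finite remaining length turns the exponential factor into a constant. Comparing with time `a`
  -- in both directions bounds `‖w‖` above and below.
  set R := Real.exp (k * (S - L a))
  have hR : 0 < R := Real.exp_pos _
  have hupper (t) (ht : t ∈ I) : ‖w t‖ ≤ C * ‖w a‖ * R :=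
    (hCk a haI t ht).trans (by
    gcongr; exact Real.exp_le_exp.2 (mul_le_mul_of_nonneg_left (hLS t ht) hk))
  have hlower (t) (ht : t ∈ I) : ‖w a‖ ≤ C * ‖w t‖ * R :=
    (hCk t ht a haI).trans (by
    rw [abs_sub_comm]
    gcongr; exact Real.exp_le_exp.2 (mul_le_mul_of_nonneg_left (hLS t ht) hk))
  have hwa : 0 < ‖w a‖ := by
    rw [norm_pos_iff, hw_def]
    exact fun h0 ↦ hg.velocity_ne_zero hne ha
      ((components_eq_zero_iff (hUc.subset_source (haU a ha le_rfl))).1 h0)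
  have hD := hUc.pos_left
  set c := ‖w a‖ / (C * D * R) with hc_def
  have hc : 0 < c := by positivity
  have hspeed (t) (ht : t ∈ I) : c ≤ ‖velocity (E := E) γ t‖ := by
    rw [hc_def, div_le_iff₀ (by positivity)]
    calc ‖w a‖ ≤ C * (D * ‖velocity (E := E) γ t‖) * R :=
          (hlower t ht).trans
            (by gcongr; exact hUc.norm_components_le _ (haU t ht.1 ht.2) _)
      _ = _ := by ring
  have hbound (t) (ht : t ∈ I) : t ≤ a + (S - L a) / c := by
    -- Speed at least `c` means that arc length grows at least like `c * t`, so bounded length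
    -- bounds the time.
    have hmono : MonotoneOn (fun t ↦ L t - c * t) I := by
      have hd (t) (ht : t ∈ I) : HasDerivAt (fun t ↦ L t - c * t)
          (‖velocity (E := E) γ t‖ - c * 1) t :=
        (hLd t ht.1).sub ((hasDerivAt_id t).const_mul c)
      refine monotoneOn_of_deriv_nonneg hI
        (fun t ht ↦ (hd t ht).continuousAt.continuousWithinAt)
        (fun t ht ↦ (hd t (interior_subset ht)).differentiableAt.differentiableWithinAt)
        fun t ht ↦ ?_
      rw [(hd t (interior_subset ht)).deriv]
      linarith [hspeed t (interior_subset ht)]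
    have h1 : L a - c * a ≤ L t - c * t := hmono haI ht ht.2
    have h2 : L t ≤ S := hS ⟨t, ht.1, rfl⟩
    rw [← sub_le_iff_le_add', le_div_iff₀ hc]
    linarith
  have hJbdd : BddAbove J := ⟨a + (S - L a) / c, fun t ht ↦ by
    rcases le_total a t with hat | hat
    · exact hbound t ⟨ht, hat⟩
    · exact hat.trans (hbound a haI)⟩
  set T := sSup J
  have hTJ : T ∉ J := by
    intro hT
    obtain ⟨ε, hε, hball⟩ := Metric.isOpen_iff.1 hg.isOpen T hT
    have h1 : T + ε / 2 ∈ J := hball (by simp [abs_of_pos hε, hε.lt])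
    linarith [le_csSup hJbdd h1]
  have hlt (t) (ht : t ∈ J) : t < T :=
    lt_of_le_of_ne (le_csSup hJbdd ht) fun h0 ↦ hTJ (h0 ▸ ht)
  have hmemJ (s) (hs : s ∈ J) (t) (ht : t ∈ Ico s T) : t ∈ J := by
    obtain ⟨u, hu, htu⟩ := exists_lt_of_lt_csSup ⟨t₀, ht₀⟩ ht.2
    exact hg.ordConnected.out hs hu ⟨ht.1, htu.le⟩
  have hIT : I = Ico a T := by
    ext t
    exact ⟨fun ht ↦ ⟨ht.2, hlt t ht.1⟩, fun ht ↦ ⟨hmemJ a ha t ht, ht.1⟩⟩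
  have hlim : Tendsto γ (𝓝[<] T) (𝓝 p) := by
    intro V hV
    obtain ⟨b, hb, hbV⟩ := hp V hV
    exact mem_map.2 (mem_of_superset (Ico_mem_nhdsLT (hlt b hb))
      fun t ht ↦ hbV t (hmemJ b hb t ht) ht.1)
  have hsource (t) (ht : t ∈ Ico a T) : γ t ∈ (chartAt E p).source := by
    rw [← hIT] at ht
    exact hUc.subset_source (haU t ht.1 ht.2)
  have hB := hUc.pos_right
  -- With `‖w‖` bounded above, the geodesic equation bounds `w'` quadratically, so `w` converges at
  -- `T`.
  obtain ⟨v, hv⟩ := exists_tendsto_nhdsLT_of_norm_deriv_le (hlt a ha) (w := w)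
    (w' := fun t ↦ -christoffel cov p (γ t) (w t) (w t))
    (C := B * (C * ‖w a‖ * R) * (C * ‖w a‖ * R))
    (fun t ht ↦ hg.hasDerivAt_components_velocity (hmemJ a ha t ht) (hsource t ht))
    (fun t ht ↦ by
      rw [← hIT] at ht
      rw [norm_neg]
      refine (hUc.norm_christoffel_le _ (haU t ht.1 ht.2) _).trans ?_
      have := hupper t ht
      gcongr)
  obtain ⟨γ', J', hγ', hJJ', heq, hTJ'⟩ := hg.exists_extension (hlt a ha) hIT hsource hlim hv
  exact hTJ (h.maximal γ' J' hγ' hJJ' heq ▸ hTJ')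

theorem IsMaximalGeodesic.lintegral_Ici_eq_top (h : IsMaximalGeodesic cov γ J)
    (hne : ∃ t₁ ∈ J, ∃ t₂ ∈ J, γ t₁ ≠ γ t₂) {t₀ : ℝ} (ht₀ : t₀ ∈ J) :
    ∫⁻ t in J ∩ Ici t₀, ‖velocity (E := E) γ t‖ₑ = ⊤ := by
  by_contra hfin
  have hg := h.isGeodesicOn
  refine h.not_bddAbove_arcLength hne ht₀
    ⟨(∫⁻ t in J ∩ Ici t₀, ‖velocity (E := E) γ t‖ₑ).toReal, ?_⟩
  have h0 : arcLength (E := E) γ t₀ t₀ = 0 := intervalIntegral.integral_same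
  rintro _ ⟨t, ht, rfl⟩
  rcases le_total t₀ t with hle | hle
  · rw [← ENNReal.ofReal_le_iff_le_toReal hfin, ← sub_zero (arcLength γ t₀ t), ← h0,
      ← lintegral_enorm_velocity hg.contMDiffOn hg.isOpen hg.ordConnected ht₀ ht₀ ht hle]
    exact lintegral_mono_set fun s hs ↦ ⟨hg.ordConnected.out ht₀ ht hs, hs.1⟩
  · refine le_trans ?_ ENNReal.toReal_nonneg
    rw [arcLength, intervalIntegral.integral_symm, neg_nonpos]
    exact intervalIntegral.integral_nonneg hle fun _ _ ↦ norm_nonneg _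

end Complete

/-! ### Time reversal -/

section Reversal

variable {E : Type*} [NormedAddCommGroup E] [NormedSpace ℝ E] [FiniteDimensional ℝ E]
  {M : Type*} [TopologicalSpace M] [ChartedSpace E M] [IsManifold 𝓘(ℝ, E) ∞ M]
  {cov : CovariantDerivative 𝓘(ℝ, E) E (fun x : M ↦ TangentSpace 𝓘(ℝ, E) x)}
  {γ : ℝ → M} {J : Set ℝ}

/-- Reversal replaces the components `w t` by `-w (-t)`. Their derivative is `w' (-t)`, with two
signs cancelling, and `Γ(w, w)` is unchanged under `w ↦ -w`. -/
theorem IsGeodesicOn.comp_neg (h : IsGeodesicOn cov γ J) :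
    IsGeodesicOn cov (γ ∘ Neg.neg) (Neg.neg ⁻¹' J) where
  isOpen := h.isOpen.preimage continuous_neg
  isConnected := (Homeomorph.neg ℝ).isConnected_preimage.2 h.isConnected
  contMDiffOn := h.contMDiffOn.comp contDiff_neg.contMDiff.contMDiffOn subset_rfl
  covAlong_eq_zero t ht := by
    have hs : (γ ∘ Neg.neg) t ∈ (chartAt E (γ (-t))).source := mem_chart_source E _
    have hsm : ContMDiffAt 𝓘(ℝ, ℝ) 𝓘(ℝ, E) 2 (γ ∘ Neg.neg) t :=
      (h.contMDiffAt (t := -t) ht).comp t contDiff_neg.contMDiff.contMDiffAt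
    have hev : ∀ τ, -τ ∈ J → γ (-τ) ∈ (chartAt E (γ (-t))).source →
        components (γ (-t)) ((γ ∘ Neg.neg) τ) (velocity (E := E) (γ ∘ Neg.neg) τ) =
          -components (γ (-t)) (γ (-τ)) (velocity (E := E) γ (-τ)) := by
      intro τ hτ hτs
      rw [velocity_comp (h.mdifferentiableAt hτ) (hasDerivAt_neg τ)]
      rw [components_eq_continuousLinearMapAt (x := (γ ∘ Neg.neg) τ) hτs,
        components_eq_continuousLinearMapAt hτs]
      exact (map_smul _ _ _).trans (neg_one_smul ℝ _)
    have hnhds : ∀ᶠ τ in 𝓝 t, -τ ∈ J ∧ γ (-τ) ∈ (chartAt E (γ (-t))).source :=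
      (continuous_neg.continuousAt.eventually (h.isOpen.mem_nhds ht)).and
        (hsm.continuousAt ((chartAt E (γ (-t))).open_source.mem_nhds hs))
    rw [covAlong_velocity_eq_zero_iff cov hs hsm, hev t ht hs,
      EventuallyEq.deriv_eq (hnhds.mono fun τ hτ ↦ hev τ hτ.1 hτ.2)]
    have h1 := ((h.hasDerivAt_components_velocity (t := -t) ht hs).scomp t
      (hasDerivAt_neg t)).fun_neg
    refine h1.deriv.trans ?_
    simp [christoffel]

theorem IsMaximalGeodesic.comp_neg (h : IsMaximalGeodesic cov γ J) :
    IsMaximalGeodesic cov (γ ∘ Neg.neg) (Neg.neg ⁻¹' J) where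
  isGeodesicOn := h.isGeodesicOn.comp_neg
  maximal γ' J' hγ' hJJ' heq := by
    have h1 := h.maximal _ _ hγ'.comp_neg
      (fun t ht ↦ hJJ' (by simpa using ht)) fun t ht ↦ by
        simpa using heq (x := -t) (by simpa using ht)
    rw [← h1, ← preimage_comp]
    simp

end Reversal

/-! ### Infinite length towards the left -/

section Complete

variable {E : Type*} [NormedAddCommGroup E] [NormedSpace ℝ E] [FiniteDimensional ℝ E]
  {M : Type*} [EMetricSpace M] [CompleteSpace M] [ChartedSpace E M] [IsManifold 𝓘(ℝ, E) ∞ M]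
  [Bundle.RiemannianBundle (fun x : M ↦ TangentSpace 𝓘(ℝ, E) x)]
  [IsContinuousRiemannianBundle E (fun x : M ↦ TangentSpace 𝓘(ℝ, E) x)]
  [IsRiemannianManifold 𝓘(ℝ, E) M]
  {cov : CovariantDerivative 𝓘(ℝ, E) E (fun x : M ↦ TangentSpace 𝓘(ℝ, E) x)}
  [cov.ContMDiffCovariantDerivative ∞] {γ : ℝ → M} {J : Set ℝ}

theorem IsMaximalGeodesic.lintegral_Iic_eq_top (h : IsMaximalGeodesic cov γ J)
    (hne : ∃ t₁ ∈ J, ∃ t₂ ∈ J, γ t₁ ≠ γ t₂) {t₀ : ℝ} (ht₀ : t₀ ∈ J) :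
    ∫⁻ t in J ∩ Iic t₀, ‖velocity (E := E) γ t‖ₑ = ⊤ := by
  obtain ⟨t₁, ht₁, t₂, ht₂, hne⟩ := hne
  rw [← h.comp_neg.lintegral_Ici_eq_top (t₀ := -t₀)
    ⟨-t₁, by simpa using ht₁, -t₂, by simpa using ht₂, by simpa using hne⟩ (by simpa using ht₀),
    ← (Measure.measurePreserving_neg (volume : Measure ℝ)).setLIntegral_comp_preimage_emb
      (Homeomorph.neg ℝ).measurableEmbedding]
  have hset : Neg.neg ⁻¹' (J ∩ Iic t₀) = Neg.neg ⁻¹' J ∩ Ici (-t₀) := by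
    ext t
    simp
  rw [hset]
  refine setLIntegral_congr_fun ?_ fun t ht ↦ ?_
  · exact ((h.isGeodesicOn.isOpen.measurableSet).preimage measurable_neg).inter measurableSet_Ici
  · rw [velocity_comp (h.isGeodesicOn.mdifferentiableAt ht.1) (hasDerivAt_neg t)]
    simp only [neg_one_smul]
    exact (enorm_neg _).symm

end Complete

/-! ### Arc-length parametrizations -/

section ChangeOfParameter

/-- A continuous bijection from an interval onto an open set maps the two sides of a point onto
the two sides of its image, in one order or the other. -/
theorem inter_subset_image_of_bijOn {f : ℝ → ℝ} {S J : Set ℝ} (hS : S.OrdConnected)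
    (hJ : IsOpen J) (hf : ContinuousOn f S) (hbij : BijOn f S J) {c : ℝ} (hc : c ∈ S) :
    (J ∩ Ici (f c) ⊆ f '' (S ∩ Ici c) ∧ J ∩ Iic (f c) ⊆ f '' (S ∩ Iic c)) ∨
      (J ∩ Iic (f c) ⊆ f '' (S ∩ Ici c) ∧ J ∩ Ici (f c) ⊆ f '' (S ∩ Iic c)) := by
  -- By injectivity the image of an interval missing `c` avoids `f c`; being connected, it lies on
  -- one side.
  have hside (A : Set ℝ) (hA : A.OrdConnected) (hcA : c ∉ A) :
      f '' (S ∩ A) ⊆ Iio (f c) ∨ f '' (S ∩ A) ⊆ Ioi (f c) := by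
    refine ((hS.inter hA).isPreconnected.image f
      (hf.mono inter_subset_left)).subset_or_subset isOpen_Iio isOpen_Ioi
        (disjoint_left.2 fun x hx hx' ↦ lt_asymm (mem_Iio.1 hx) (mem_Ioi.1 hx')) ?_
    rintro _ ⟨s, hs, rfl⟩
    exact lt_or_gt_of_ne fun h0 ↦ hcA (hbij.injOn hs.1 hc h0 ▸ hs.2)
  have hsplit (y) (hy : y ∈ J) : y ∈ f '' (S ∩ Iio c) ∨ y = f c ∨ y ∈ f '' (S ∩ Ioi c) := by
    obtain ⟨s, hs, rfl⟩ := hbij.surjOn hy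
    rcases lt_trichotomy s c with h | rfl | h
    · exact .inl ⟨s, ⟨hs, h⟩, rfl⟩
    · exact .inr (.inl rfl)
    · exact .inr (.inr ⟨s, ⟨hs, h⟩, rfl⟩)
  have hcl : f c ∈ f '' (S ∩ Iic c) := ⟨c, ⟨hc, self_mem_Iic⟩, rfl⟩
  have hcr : f c ∈ f '' (S ∩ Ici c) := ⟨c, ⟨hc, self_mem_Ici⟩, rfl⟩
  have hl : f '' (S ∩ Iio c) ⊆ f '' (S ∩ Iic c) :=
    image_mono (inter_subset_inter_right _ Iio_subset_Iic_self)
  have hr : f '' (S ∩ Ioi c) ⊆ f '' (S ∩ Ici c) :=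
    image_mono (inter_subset_inter_right _ Ioi_subset_Ici_self)
  -- Since `J` is open it has points on both sides of `f c`, so the two halves of `S` cannot go to
  -- the same side.
  obtain ⟨ε, hε, hball⟩ := Metric.isOpen_iff.1 hJ _ (hbij.mapsTo hc)
  have hεl : f c - ε / 2 ∈ J := hball (by simp [abs_of_pos hε, hε.lt])
  have hεr : f c + ε / 2 ∈ J := hball (by simp [abs_of_pos hε, hε.lt])
  rcases hside (Iio c) ordConnected_Iio self_notMem_Iio with h1 | h1 <;>
    rcases hside (Ioi c) ordConnected_Ioi self_notMem_Ioi with h2 | h2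
  · rcases hsplit _ hεr with h | h | h
    · linarith [mem_Iio.1 (h1 h)]
    · linarith
    · linarith [mem_Iio.1 (h2 h)]
  · refine .inl ⟨fun y hy ↦ ?_, fun y hy ↦ ?_⟩ <;> rcases hsplit y hy.1 with h | rfl | h
    · linarith [mem_Iio.1 (h1 h), mem_Ici.1 hy.2]
    · exact hcr
    · exact hr h
    · exact hl h
    · exact hcl
    · linarith [mem_Ioi.1 (h2 h), mem_Iic.1 hy.2]
  · refine .inr ⟨fun y hy ↦ ?_, fun y hy ↦ ?_⟩ <;> rcases hsplit y hy.1 with h | rfl | h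
    · linarith [mem_Ioi.1 (h1 h), mem_Iic.1 hy.2]
    · exact hcr
    · exact hr h
    · exact hl h
    · exact hcl
    · linarith [mem_Iio.1 (h2 h), mem_Ici.1 hy.2]
  · rcases hsplit _ hεl with h | h | h
    · linarith [mem_Ioi.1 (h1 h)]
    · linarith
    · linarith [mem_Ioi.1 (h2 h)]

variable {E : Type*} [NormedAddCommGroup E] [NormedSpace ℝ E]
  {M : Type*} [TopologicalSpace M] [ChartedSpace E M] [IsManifold 𝓘(ℝ, E) ∞ M]
  [Bundle.RiemannianBundle (fun x : M ↦ TangentSpace 𝓘(ℝ, E) x)]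
  {γ r : ℝ → M} {J S : Set ℝ}

omit [IsManifold 𝓘(ℝ, E) ∞ M] [Bundle.RiemannianBundle (fun x : M ↦ TangentSpace 𝓘(ℝ, E) x)] in
theorem velocity_congr_norm [∀ x : M, Norm (TangentSpace 𝓘(ℝ, E) x)] {γ γ' : ℝ → M} {t : ℝ}
    (h : γ =ᶠ[𝓝 t] γ') :
    ‖velocity (E := E) γ t‖ = ‖velocity (E := E) γ' t‖ := by
  let n (x : M) (v : E) : ℝ := norm (E := TangentSpace 𝓘(ℝ, E) x) v
  change n (γ t) (velocity (E := E) γ t) = n (γ' t) (velocity (E := E) γ' t)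
  rw [h.eq_of_nhds, velocity_congr h]

omit [IsManifold 𝓘(ℝ, E) ∞ M] in
/-- In an arc-length parametrization, the length of an arc is the measure of the parameter set. -/
theorem lintegral_image_of_unit_speed {φ : ℝ → ℝ} (hγ : ∀ t ∈ J, MDiffAt γ t) (hS : IsOpen S)
    (hφ : DifferentiableOn ℝ φ S) (hbij : BijOn φ S J)
    (hunit : ∀ s ∈ S, ‖velocity (E := E) (γ ∘ φ) s‖ = 1) {A : Set ℝ} (hA : MeasurableSet A)
    (hAS : A ⊆ S) :
    ∫⁻ t in φ '' A, ‖velocity (E := E) γ t‖ₑ = volume A := by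
  have hd (s) (hs : s ∈ A) : HasDerivAt φ (deriv φ s) s :=
    ((hφ s (hAS hs)).differentiableAt (hS.mem_nhds (hAS hs))).hasDerivAt
  rw [lintegral_image_eq_lintegral_abs_deriv_mul hA (fun s hs ↦ (hd s hs).hasDerivWithinAt)
    (hbij.injOn.mono hAS), setLIntegral_congr_fun (g := fun _ ↦ 1) hA]
  · simp
  · intro s hs
    have h1 := hunit s (hAS hs)
    rw [velocity_comp (hγ _ (hbij.mapsTo (hAS hs))) (hd s hs), norm_smul, Real.norm_eq_abs] at h1
    simp only
    rw [← ofReal_norm, ← ENNReal.ofReal_mul (abs_nonneg _)]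
    exact (congrArg _ h1).trans ENNReal.ofReal_one

/-- A point missing from `S` would confine one half of the interval to a compact one, of finite
measure. -/
theorem eq_univ_of_measure_eq_top (hS : S.OrdConnected) (hne : S.Nonempty)
    (h : ∀ c ∈ S, volume (S ∩ Ici c) = ⊤ ∧ volume (S ∩ Iic c) = ⊤) : S = univ := by
  obtain ⟨c, hc⟩ := hne
  refine eq_univ_of_forall fun x ↦ by_contra fun hx ↦ ?_
  rcases le_total c x with hcx | hcx
  · have hsub : S ∩ Ici c ⊆ Icc c x := fun y hy ↦
      ⟨hy.2, le_of_not_ge fun hxy ↦ hx (hS.out hc hy.1 ⟨hcx, hxy⟩)⟩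
    have := (measure_mono (μ := volume) hsub).trans_lt measure_Icc_lt_top
    exact this.ne (h c hc).1
  · have hsub : S ∩ Iic c ⊆ Icc x c := fun y hy ↦
      ⟨le_of_not_ge fun hxy ↦ hx (hS.out hy.1 hc ⟨hxy, hcx⟩), hy.2⟩
    have := (measure_mono (μ := volume) hsub).trans_lt measure_Icc_lt_top
    exact this.ne (h c hc).2

omit [IsManifold 𝓘(ℝ, E) ∞ M] in
-- Each half of `S` at `c` maps onto a set containing a half of `J` at `φ c`, and both halves of `J`
-- have infinite length; so the orientation of `φ` is immaterial.
theorem IsArcLengthParametrization.eq_univ (h : IsArcLengthParametrization (E := E) γ J r S)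
    (hγ : ∀ t ∈ J, MDiffAt γ t) (hJ : IsOpen J)
    (htop : ∀ t ∈ J, ∫⁻ τ in J ∩ Ici t, ‖velocity (E := E) γ τ‖ₑ = ⊤ ∧
      ∫⁻ τ in J ∩ Iic t, ‖velocity (E := E) γ τ‖ₑ = ⊤) : S = univ := by
  obtain ⟨φ, hφ, hbij, hr⟩ := h.exists_reparam
  have hSc : S.OrdConnected := h.isConnected.isPreconnected.ordConnected
  have hunit (s) (hs : s ∈ S) : ‖velocity (E := E) (γ ∘ φ) s‖ = 1 := by
    rw [← velocity_congr_norm (eventuallyEq_of_mem (h.isOpen.mem_nhds hs) hr)]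
    exact h.unit_speed s hs
  have hlen (A : Set ℝ) (hA : MeasurableSet A) (hAS : A ⊆ S) :=
    lintegral_image_of_unit_speed hγ h.isOpen (hφ.differentiableOn (by simp)) hbij hunit hA hAS
  refine eq_univ_of_measure_eq_top hSc h.isConnected.nonempty fun c hc ↦ ?_
  rw [← hlen _ (h.isOpen.measurableSet.inter measurableSet_Ici) inter_subset_left,
    ← hlen _ (h.isOpen.measurableSet.inter measurableSet_Iic) inter_subset_left]
  obtain ⟨h1, h2⟩ := htop _ (hbij.mapsTo hc)
  rcases inter_subset_image_of_bijOn hSc hJ hφ.continuousOn hbij hc with ⟨h3, h4⟩ | ⟨h3, h4⟩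
  · exact ⟨top_le_iff.1 (h1.symm.trans_le (lintegral_mono_set h3)),
      top_le_iff.1 (h2.symm.trans_le (lintegral_mono_set h4))⟩
  · exact ⟨top_le_iff.1 (h2.symm.trans_le (lintegral_mono_set h3)),
      top_le_iff.1 (h1.symm.trans_le (lintegral_mono_set h4))⟩

/-- The parameter change is the inverse of the arc-length function, whose derivative, the speed, is
continuous and positive. -/
theorem exists_isArcLengthParametrization
    [IsContinuousRiemannianBundle E (fun x : M ↦ TangentSpace 𝓘(ℝ, E) x)]
    (hγ : ContMDiffOn 𝓘(ℝ, ℝ) 𝓘(ℝ, E) 2 γ J) (hJ : IsOpen J) (hJc : IsConnected J)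
    (hv : ∀ t ∈ J, velocity (E := E) γ t ≠ 0) :
    ∃ r S, IsArcLengthParametrization (E := E) γ J r S := by
  have hJo : J.OrdConnected := hJc.isPreconnected.ordConnected
  obtain ⟨t₀, ht₀⟩ := hJc.nonempty
  set L := arcLength (E := E) γ t₀
  have hpos (t) (ht : t ∈ J) : 0 < ‖velocity (E := E) γ t‖ := norm_pos_iff.2 (hv t ht)
  have hL (t) (ht : t ∈ J) : HasDerivAt L ‖velocity (E := E) γ t‖ t :=
    hasDerivAt_arcLength hγ hJ hJo ht₀ ht
  have hLc : ContinuousOn L J := fun t ht ↦ (hL t ht).continuousAt.continuousWithinAt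
  have hLmono : StrictMonoOn L J := by
    refine strictMonoOn_of_deriv_pos hJo.convex hLc fun t ht ↦ ?_
    rw [(hL t (interior_subset ht)).deriv]
    exact hpos t (interior_subset ht)
  set S := L '' J
  have hnhds (t) (ht : t ∈ J) : S ∈ 𝓝 (L t) := by
    have hs : HasStrictDerivAt L ‖velocity (E := E) γ t‖ t :=
      hasStrictDerivAt_of_hasDerivAt_of_continuousAt
        (f' := fun τ ↦ ‖velocity (E := E) γ τ‖)
        (eventually_of_mem (hJ.mem_nhds ht) hL)
        ((continuousOn_norm_velocity hγ hJ).continuousAt (hJ.mem_nhds ht))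
    rw [← hs.map_nhds_eq (hpos t ht).ne']
    exact image_mem_map (hJ.mem_nhds ht)
  have hSo : IsOpen S := by
    rw [isOpen_iff_mem_nhds]
    rintro _ ⟨t, ht, rfl⟩
    exact hnhds t ht
  set φ := Function.invFunOn L J
  have hLbij : BijOn L J S := hLmono.injOn.bijOn_image
  have hinv : InvOn φ L J S := hLbij.invOn_invFunOn
  have hφJ : MapsTo φ S J := fun s hs ↦ Function.invFunOn_mem hs
  have hbij : BijOn φ S J := hinv.symm.bijOn hφJ hLbij.mapsTo
  have hφmono : MonotoneOn φ S := fun s hs s' hs' hle ↦ by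
    rwa [← hLmono.le_iff_le (hφJ hs) (hφJ hs'), hinv.2 hs, hinv.2 hs']
  -- A monotone function whose image is a neighbourhood of its value is continuous there.
  have hφc (s) (hs : s ∈ S) : ContinuousAt φ s := by
    refine continuousAt_of_monotoneOn_of_image_mem_nhds hφmono (hSo.mem_nhds hs) ?_
    rw [hbij.image_eq]
    exact hJ.mem_nhds (hφJ hs)
  have hφd (s) (hs : s ∈ S) : HasDerivAt φ ‖velocity (E := E) γ (φ s)‖⁻¹ s :=
    (hL _ (hφJ hs)).of_local_left_inverse (hφc s hs) (hpos _ (hφJ hs)).ne'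
      (eventually_of_mem (hSo.mem_nhds hs) fun y hy ↦ hinv.2 hy)
  refine ⟨γ ∘ φ, S, hSo, hJc.image L hLc, ⟨φ, ?_, hbij, fun _ _ ↦ rfl⟩, fun s hs ↦ ?_⟩
  · have h1 : ContDiffOn ℝ (0 + 1) φ S := by
      rw [contDiffOn_succ_iff_deriv_of_isOpen hSo]
      refine ⟨fun s hs ↦ (hφd s hs).differentiableAt.differentiableWithinAt, by simp, ?_⟩
      refine contDiffOn_zero.2 (ContinuousOn.congr ?_ fun s hs ↦ (hφd s hs).deriv)
      exact ((continuousOn_norm_velocity hγ hJ).comp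
        (fun s hs ↦ (hφc s hs).continuousWithinAt) hφJ).inv₀ fun s hs ↦ (hpos _ (hφJ hs)).ne'
    rwa [zero_add] at h1
  · rw [velocity_comp ((hγ.contMDiffAt (hJ.mem_nhds (hφJ hs))).mdifferentiableAt (by simp))
      (hφd s hs), norm_smul, norm_inv, norm_norm]
    exact inv_mul_cancel₀ (hpos _ (hφJ hs)).ne'

end ChangeOfParameter
end AffineGeodesic

/-! ### The main theorem -/

theorem proposition3p7
    {E : Type*} [NormedAddCommGroup E] [NormedSpace ℝ E] [FiniteDimensional ℝ E]
    {M : Type*} [EMetricSpace M] [ChartedSpace E M] [IsManifold 𝓘(ℝ, E) ∞ M]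
    [Bundle.RiemannianBundle (fun x : M ↦ TangentSpace 𝓘(ℝ, E) x)]
    [IsContMDiffRiemannianBundle 𝓘(ℝ, E) ∞ E (fun x : M ↦ TangentSpace 𝓘(ℝ, E) x)]
    [IsRiemannianManifold 𝓘(ℝ, E) M] [CompleteSpace M]
    (cov : CovariantDerivative 𝓘(ℝ, E) E (fun x : M ↦ TangentSpace 𝓘(ℝ, E) x))
    [cov.ContMDiffCovariantDerivative ∞]
    (γ : ℝ → M) (J : Set ℝ)
    (hγ : AffineGeodesic.IsMaximalGeodesic cov γ J)
    (hnonconst : ∃ t₁ ∈ J, ∃ t₂ ∈ J, γ t₁ ≠ γ t₂) :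
    (∃ (r : ℝ → M) (S : Set ℝ),
      AffineGeodesic.IsArcLengthParametrization (E := E) γ J r S) ∧
    (∀ (r : ℝ → M) (S : Set ℝ),
      AffineGeodesic.IsArcLengthParametrization (E := E) γ J r S → S = univ) ∧
    AffineGeodesic.curveLength (E := E) γ J = ⊤ := by
  have : IsContinuousRiemannianBundle E (fun x : M ↦ TangentSpace 𝓘(ℝ, E) x) := by
    obtain ⟨g, hg, h⟩ := IsContMDiffRiemannianBundle.exists_contMDiff (IB := 𝓘(ℝ, E)) (n := ∞)
      (F := E) (E := fun x : M ↦ TangentSpace 𝓘(ℝ, E) x)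
    exact ⟨g, hg.continuous, h⟩
  have hg := hγ.isGeodesicOn
  refine ⟨AffineGeodesic.exists_isArcLengthParametrization hg.contMDiffOn hg.isOpen hg.isConnected
    fun t ht ↦ hg.velocity_ne_zero hnonconst ht, fun r S hr ↦ ?_, ?_⟩
  · exact hr.eq_univ (fun t ht ↦ hg.mdifferentiableAt ht) hg.isOpen fun t ht ↦
      ⟨hγ.lintegral_Ici_eq_top hnonconst ht, hγ.lintegral_Iic_eq_top hnonconst ht⟩
  · obtain ⟨t, ht⟩ := hg.isConnected.nonempty
    exact top_le_iff.1 ((hγ.lintegral_Ici_eq_top hnonconst ht).symm.trans_le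
      (lintegral_mono_set inter_subset_left))
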